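/- Let $\alpha>-1$ and $s>0$. Let $\mathbb D\subset\mathbb C$ be the open unit disk, $dz$ the Lebesgue measure, and let $\mathbf B^2_\alpha$ be the space of holomorphic functions $f$ on $\mathbb D$ with $\|f\|_{\mathbf B^2_\alpha}^2=\int_{\mathbb D}|f(z)|^2(1-|z|^2)^\alpha\,dz<\infty$, with scalar product $\langle f,g\rangle_\alpha=\int_{\mathbb D} f\,\overline g\,(1-|z|^2)^\alpha\,dz$. Let $d\mu(z)=(1-|z|^2)^{-2}dz$ be the hyperbolic measure on $\mathbb D$. For $f\in\mathbf B^2_\alpha$ put $u_f(z)=|f(z)|^2(1-|z|^2)^{\alpha+2}$, let $u_f^*(s)=\inf\{t\ge 0:\mu(\{u_f>t\})\le s\}$ be its decreasing rearrangement with respect to $\mu$ (the inverse of the distribution function $t\mapsto\mu(\{u_f>t\})$), and, for $f\neq0$, set $$\mathcal K_\alpha[f]=\frac{1}{\|f\|_{\mathbf B^2_\alpha}^2}\int_{\{u_f>u_f^*(s)\}}u_f\,d\mu .$$ Let $\mathbf f_0=\sqrt{(\alpha+1)/\pi}$ be the constant function of norm $1$. Then for every $g\in\mathbf B^2_\alpha$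 with $\|g\|_{\mathbf B^2_\alpha}=1$ and $\langle g,1\rangle_\alpha=\langle g,z\rangle_\alpha=0$, the function $\varepsilon\mapsto\mathcal K_\alpha[\mathbf f_0+\varepsilon g]$ of the real variable $\varepsilon$ is twice differentiable at $\varepsilon=0$, and its second derivative there, $\nabla^2\mathcal K_\alpha[\mathbf f_0](g,g)$, satisfies $$\frac12\nabla^2\mathcal K_\alpha[\mathbf f_0](g,g)\le-\frac{\alpha+1}{2}\,\pi^{\alpha+1}\,s\,(\pi+s)^{-3-\alpha}\,(s+2\pi).$$ -/

import Mathlib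

open Real MeasureTheory Filter Topology

noncomputable section

namespace Bergman

/-- The open unit disk of `ℂ`. -/
def disk : Set ℂ := Metric.ball 0 1

/-- The weighted Bergman space of the unit disk: functions holomorphic in the disk with
`∫_𝔻 |f|² (1 - |z|²)^α dz < ∞`. Only the values in the disk matter. -/
def space (α : ℝ) : Set (ℂ → ℂ) :=
  {f | DifferentiableOn ℂ f disk ∧
    IntegrableOn (fun z => ‖f z‖ ^ 2 * (1 - ‖z‖ ^ 2) ^ α) disk volume}

/-- The scalar product `⟨f, g⟩ = ∫_𝔻 f \bar g (1 - |z|²)^α dz`. -/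
def scalar (α : ℝ) (f g : ℂ → ℂ) : ℂ :=
  ∫ z in disk, f z * (starRingEnd ℂ) (g z) * (((1 - ‖z‖ ^ 2) ^ α : ℝ) : ℂ)

/-- The norm of the weighted Bergman space. -/
def norm (α : ℝ) (f : ℂ → ℂ) : ℝ :=
  √(∫ z in disk, ‖f z‖ ^ 2 * (1 - ‖z‖ ^ 2) ^ α)

/-- The hyperbolic measure `(1 - |z|²)⁻² dz` on the disk. -/
def hyp : Measure ℂ :=
  (volume.restrict disk).withDensity (fun z => ENNReal.ofReal (((1 - ‖z‖ ^ 2) ^ 2)⁻¹))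

/-- `u(z) = |f(z)|² (1 - |z|²)^(α + 2)`. -/
def u (α : ℝ) (f : ℂ → ℂ) (z : ℂ) : ℝ := ‖f z‖ ^ 2 * (1 - ‖z‖ ^ 2) ^ (α + 2)

/-- The superlevel set `{z ∈ 𝔻 : u(z) > t}`. -/
def superlevel (α : ℝ) (f : ℂ → ℂ) (t : ℝ) : Set ℂ := {z | z ∈ disk ∧ t < u α f z}

/-- The decreasing rearrangement `u^*(s)`: the (generalized) inverse at `s` of the distribution
function `t ↦ μ({u > t})`, with `μ` the hyperbolic measure. -/
def uStar (α : ℝ) (f : ℂ → ℂ) (s : ℝ) : ℝ :=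
  sInf {t : ℝ | 0 ≤ t ∧ hyp (superlevel α f t) ≤ ENNReal.ofReal s}

/-- `I_f(s) = ∫_{u > u^*(s)} u dμ`. -/
def I (α : ℝ) (f : ℂ → ℂ) (s : ℝ) : ℝ :=
  ∫ z in superlevel α f (uStar α f s), u α f z ∂hyp

/-- The functional `𝒦_α[f] = I_f(s) / ‖f‖²`. -/
def K (α s : ℝ) (f : ℂ → ℂ) : ℝ := I α f s / norm α f ^ 2

/-- The normalized constant function `f₀ = √((α + 1) / π)`. -/
def f₀ (α : ℝ) : ℂ → ℂ := fun _ => ((√((α + 1) / π) : ℝ) : ℂ)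

/-- `ε ↦ 𝒦_α[f₀ + ε g]`, for real `ε`. -/
def KLine (α s : ℝ) (g : ℂ → ℂ) (ε : ℝ) : ℝ := K α s (fun z => f₀ α z + (ε : ℂ) * g z)

/-- The second variation `∇²𝒦_α[f₀](g, g) = d²/dε² 𝒦_α[f₀ + ε g]` at `ε = 0`. -/
def secondVariation (α s : ℝ) (g : ℂ → ℂ) : ℝ := deriv (deriv (KLine α s g)) 0

/-- `ε ↦ 𝒦_α[f₀ + ε g]` is twice differentiable at `0`, so that the second variation is a genuine
second derivative. -/
def HasSecondVariation (α s : ℝ) (g : ℂ → ℂ) : Prop :=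
  (∀ᶠ ε in 𝓝 (0 : ℝ), DifferentiableAt ℝ (KLine α s g) ε) ∧
    DifferentiableAt ℝ (deriv (KLine α s g)) 0

end Bergman

end

/-!
The number `I α f s` is the maximum of `∫ z in E, u α f z ∂hyp` over the sets `E` of hyperbolic area
`s`. Along the line `f = f₀ + ε g` its derivative is therefore the integral of `∂u/∂ε` over the
optimal superlevel set: this integral is a subgradient, and it depends continuously on `ε`. For `f₀`
the optimal set is the disk of radius `R` with `R² = s / (π + s)`, so a second differentiation only
needs the first variation at `ε = 0` of the superlevel set, which is visible on rays rescaled by `ε`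
around `r = R`. Since `g 0 = 0`, the mean of `Re g` over circles vanishes; hence the area of the
superlevel set is stationary at fixed level, and half the second derivative is an explicit quadratic
form in `g`.

As `⟨f₀, g⟩ = 0`, the squared norm of `f₀ + ε g` is `1 + ε² ‖g‖²`, so it remains to bound the
quadratic form by a multiple of `‖g‖²`. Orthogonality to `1` and `z` gives `g = z² h`, the circle
means of `|h|²` are nondecreasing in the radius, and comparing them with their value at `R`
(Chebyshev's inequality) shows that `g = z²` is extremal.
-/

noncomputable section

namespace Bergman

section PolarCoordinates

variable {E : Type*} [NormedAddCommGroup E]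

lemma polarCoord_symm_eq_circleMap (p : ℝ × ℝ) :
    Complex.polarCoord.symm p = circleMap 0 p.1 p.2 := by
  rw [Complex.polarCoord_symm_apply, circleMap_zero, Complex.exp_mul_I, Complex.ofReal_cos,
    Complex.ofReal_sin]

lemma circleIntegrable_of_continuousOn_ball {f : ℂ → E} {c : ℂ} {r R : ℝ}
    (hf : ContinuousOn f (Metric.ball c R)) (hr : 0 ≤ r) (hrR : r < R) :
    CircleIntegrable f c r :=
  (hf.mono (Metric.sphere_subset_closedBall.trans
    (Metric.closedBall_subset_ball hrR))).circleIntegrable hr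

variable [NormedSpace ℝ E]

lemma integral_eq_integral_polar (f : ℂ → E) :
    ∫ z, f z = ∫ p in polarCoord.target, p.1 • f (circleMap 0 p.1 p.2) := by
  simp only [← Complex.integral_comp_polarCoord_symm, polarCoord_symm_eq_circleMap]

lemma integrableOn_polar {f : ℂ → E} (hf : Integrable f) :
    IntegrableOn (fun p : ℝ × ℝ => p.1 • f (circleMap 0 p.1 p.2)) polarCoord.target := by
  have hplane : Integrable (fun p : ℝ × ℝ => f (Complex.measurableEquivRealProd.symm p)) :=
    (Complex.volume_preserving_equiv_real_prod.symm.integrable_comp_emb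
      Complex.measurableEquivRealProd.symm.measurableEmbedding).2 hf
  refine ((integrableOn_image_iff_integrableOn_abs_det_fderiv_smul volume
    polarCoord.open_target.measurableSet
    (fun p _ => (hasFDerivAt_polarCoord_symm p).hasFDerivWithinAt) polarCoord.symm.injOn
    (fun p : ℝ × ℝ => f (Complex.measurableEquivRealProd.symm p))).1 hplane.integrableOn).congr_fun
    (fun p hp => ?_) polarCoord.open_target.measurableSet
  have hp_pos : 0 < p.1 := hp.1
  simp only [det_fderivPolarCoordSymm, abs_of_pos hp_pos,
    Complex.measurableEquivRealProd_symm_polarCoord_symm_apply, polarCoord_symm_eq_circleMap]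

lemma integral_Ioo_circleMap_eq_circleAverage (f : ℂ → E) (r : ℝ) :
    ∫ θ in Set.Ioo (-π) π, f (circleMap 0 r θ) = (2 * π) • circleAverage f 0 r := by
  have hperiodic := ((periodic_circleMap 0 r).comp f).intervalIntegral_add_eq (-π) 0
  rw [show -π + 2 * π = π by ring, zero_add] at hperiodic
  rw [circleAverage_def, smul_inv_smul₀ (by positivity), ← integral_Ioc_eq_integral_Ioo,
    ← intervalIntegral.integral_of_le (by linarith [pi_pos])]
  exact hperiodic

lemma integral_Ioo_smul_circleMap (f : ℂ → E) (r : ℝ) :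
    ∫ θ in Set.Ioo (-π) π, r • f (circleMap 0 r θ) = (2 * π * r) • circleAverage f 0 r := by
  rw [integral_smul, integral_Ioo_circleMap_eq_circleAverage, smul_smul, mul_comm]

lemma integrable_polar_prod {f : ℂ → E} (hf : Integrable f) :
    Integrable (fun p : ℝ × ℝ => p.1 • f (circleMap 0 p.1 p.2))
      ((volume.restrict (Set.Ioi 0)).prod (volume.restrict (Set.Ioo (-π) π))) := by
  rw [Measure.prod_restrict, ← Measure.volume_eq_prod]
  exact integrableOn_polar hf

lemma integrableOn_Ioi_circleAverage {f : ℂ → E} (hf : Integrable f) :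
    IntegrableOn (fun r : ℝ => (2 * π * r) • circleAverage f 0 r) (Set.Ioi 0) := by
  simpa only [IntegrableOn, integral_Ioo_smul_circleMap] using
    (integrable_polar_prod hf).integral_prod_left

lemma integral_eq_integral_circleAverage {f : ℂ → E} (hf : Integrable f) :
    ∫ z, f z = ∫ r in Set.Ioi (0 : ℝ), (2 * π * r) • circleAverage f 0 r := by
  have hprod := integral_prod _ (integrable_polar_prod hf)
  rw [Measure.prod_restrict, ← Measure.volume_eq_prod] at hprod
  simpa only [integral_Ioo_smul_circleMap] using (integral_eq_integral_polar f).trans hprod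

lemma circleAverage_radial_smul (f : ℂ → E) (w : ℝ → ℝ) {r : ℝ} (hr : 0 ≤ r) :
    circleAverage (fun z => w ‖z‖ • f z) 0 r = w r • circleAverage f 0 r := by
  rw [← circleAverage_fun_smul]
  refine circleAverage_congr_sphere fun z hz => ?_
  rw [mem_sphere_zero_iff_norm, abs_of_nonneg hr] at hz
  simp only [hz]

lemma circleAverage_indicator_ball [CompleteSpace E] (f : ℂ → E) (ρ : ℝ) {r : ℝ} (hr : 0 ≤ r) :
    circleAverage ((Metric.ball 0 ρ).indicator f) 0 r =
      (Set.Iio ρ).indicator (fun r => circleAverage f 0 r) r := by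
  have hnorm : ∀ z ∈ Metric.sphere (0 : ℂ) |r|, ‖z‖ = r := fun z hz => by
    rwa [mem_sphere_zero_iff_norm, abs_of_nonneg hr] at hz
  by_cases hrρ : r < ρ
  · rw [Set.indicator_of_mem (Set.mem_Iio.2 hrρ)]
    refine circleAverage_congr_sphere fun z hz => Set.indicator_of_mem ?_ f
    rwa [mem_ball_zero_iff, hnorm z hz]
  · rw [Set.indicator_of_notMem (Set.notMem_Iio.2 (not_lt.1 hrρ))]
    refine circleAverage_const_on_circle fun z hz => Set.indicator_of_notMem ?_ f
    rwa [mem_ball_zero_iff, hnorm z hz]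

lemma integrableOn_Ioo_circleAverage [CompleteSpace E] {f : ℂ → E} {ρ : ℝ}
    (hf : IntegrableOn f (Metric.ball 0 ρ)) :
    IntegrableOn (fun r : ℝ => (2 * π * r) • circleAverage f 0 r) (Set.Ioo 0 ρ) := by
  have h := integrableOn_Ioi_circleAverage ((integrable_indicator_iff measurableSet_ball).2 hf)
  refine (h.mono_set Set.Ioo_subset_Ioi_self).congr_fun (fun r hr => ?_) measurableSet_Ioo
  simp only [circleAverage_indicator_ball _ _ hr.1.le, Set.indicator_of_mem (Set.mem_Iio.2 hr.2)]

lemma setIntegral_ball_eq_integral_circleAverage [CompleteSpace E] {f : ℂ → E} {ρ : ℝ}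
    (hf : IntegrableOn f (Metric.ball 0 ρ)) :
    ∫ z in Metric.ball 0 ρ, f z = ∫ r in Set.Ioo 0 ρ, (2 * π * r) • circleAverage f 0 r := by
  rw [← integral_indicator measurableSet_ball, integral_eq_integral_circleAverage
    ((integrable_indicator_iff measurableSet_ball).2 hf), ← Set.Ioi_inter_Iio,
    ← setIntegral_indicator measurableSet_Iio]
  refine setIntegral_congr_fun measurableSet_Ioi fun r hr => ?_
  simp only [circleAverage_indicator_ball _ _ hr.le, ← Set.indicator_smul_apply]

end PolarCoordinates

section CircleMeans

lemma circleAverage_polynomial_sq_norm (p : Polynomial ℂ) (r : ℝ) :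
    circleAverage (fun z => ‖p.eval z‖ ^ 2) 0 r = p.sum fun i a => ‖a‖ ^ 2 * (r ^ 2) ^ i := by
  set q : Polynomial ℂ := p.comp (Polynomial.C (r : ℂ) * Polynomial.X)
  have hcoeff : ∀ i, q.coeff i = p.coeff i * (r : ℂ) ^ i := fun i =>
    Polynomial.comp_C_mul_X_coeff
  have hsupport : q.support ⊆ p.support := fun i hi => by
    rw [Polynomial.mem_support_iff, hcoeff] at hi
    exact Polynomial.mem_support_iff.2 (left_ne_zero_of_mul hi)
  calc circleAverage (fun z => ‖p.eval z‖ ^ 2) 0 r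
      = circleAverage (fun z => ‖q.eval z‖ ^ 2) 0 1 := by
        rw [circleAverage_eq_circleAverage_zero_one]
        simp only [q, Polynomial.eval_comp, Polynomial.eval_mul, Polynomial.eval_C,
          Polynomial.eval_X, add_zero]
    _ = ∑ i ∈ p.support, ‖q.coeff i‖ ^ 2 := by
        rw [← q.sum_sq_norm_coeff_eq_circleAverage]
        refine Finset.sum_subset hsupport fun i _ hi => ?_
        rw [Polynomial.notMem_support_iff.1 hi, norm_zero, zero_pow two_ne_zero]
    _ = p.sum fun i a => ‖a‖ ^ 2 * (r ^ 2) ^ i := by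
        refine Finset.sum_congr rfl fun i _ => ?_
        rw [hcoeff, norm_mul, norm_pow, Complex.norm_real, mul_pow, Real.norm_eq_abs,
          pow_right_comm, sq_abs]

lemma tendsto_circleAverage_sq_norm {F : ℕ → ℂ → ℂ} {f : ℂ → ℂ} {c : ℂ} {r : ℝ}
    (hF : ∀ n, Continuous (F n)) (hf : ContinuousOn f (Metric.sphere c |r|))
    (hlim : TendstoUniformlyOn F f atTop (Metric.sphere c |r|)) :
    Tendsto (fun n => circleAverage (fun z => ‖F n z‖ ^ 2) c r) atTop
      (𝓝 (circleAverage (fun z => ‖f z‖ ^ 2) c r)) := by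
  obtain ⟨M, hM⟩ := (isCompact_sphere c |r|).exists_bound_of_continuousOn hf
  simp only [circleAverage_def]
  refine (intervalIntegral.tendsto_integral_filter_of_dominated_convergence
    (fun _ => (M + 1) ^ 2) ?_ ?_ intervalIntegrable_const ?_).const_smul _
  · exact Eventually.of_forall fun n =>
      (((hF n).comp (continuous_circleMap c r)).norm.pow 2).aestronglyMeasurable
  · filter_upwards [Metric.tendstoUniformlyOn_iff.1 hlim 1 one_pos] with n hn
    refine ae_of_all _ fun θ _ => ?_
    have hθ := circleMap_mem_sphere' c r θ
    have hdist := (hn _ hθ).le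
    rw [dist_comm, dist_eq_norm] at hdist
    rw [norm_pow, norm_norm]
    gcongr
    linarith [hM _ hθ, norm_le_norm_add_norm_sub' (F n (circleMap c r θ)) (f (circleMap c r θ))]
  · exact ae_of_all _ fun θ _ => (hlim.tendsto_at (circleMap_mem_sphere' c r θ)).norm.pow 2

lemma exists_polynomial_tendstoUniformlyOn {f : ℂ → ℂ} {R ρ : ℝ} (hRρ : R < ρ)
    (hf : DifferentiableOn ℂ f (Metric.ball 0 ρ)) :
    ∃ q : ℕ → Polynomial ℂ,
      TendstoUniformlyOn (fun n z => (q n).eval z) f atTop (Metric.closedBall 0 R) := by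
  rcases lt_or_ge R 0 with hR | hR
  · exact ⟨0, by simp [Metric.closedBall_eq_empty.2 hR, tendstoUniformlyOn_empty]⟩
  obtain ⟨ρ₁, hRρ₁, hρ₁ρ⟩ := exists_between hRρ
  obtain ⟨ρ₂, hRρ₂, hρ₂ρ₁⟩ := exists_between hRρ₁
  lift ρ₁ to NNReal using hR.trans hRρ₁.le
  lift ρ₂ to NNReal using hR.trans hRρ₂.le
  have hseries := (hf.mono (Metric.closedBall_subset_ball hρ₁ρ)).hasFPowerSeriesOnBall
    (NNReal.coe_pos.1 (hR.trans_lt hRρ₁))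
  have hlim := hseries.tendstoUniformlyOn (r' := ρ₂) (by exact_mod_cast hρ₂ρ₁)
  simp only [zero_add] at hlim
  refine ⟨fun n => ∑ k ∈ Finset.range n,
    Polynomial.C ((cauchyPowerSeries f 0 ρ₁).coeff k) * Polynomial.X ^ k, ?_⟩
  refine (hlim.mono (Metric.closedBall_subset_ball hRρ₂)).congr (Eventually.of_forall ?_)
  intro n z _
  simp only [Polynomial.eval_finsetSum, FormalMultilinearSeries.partialSum,
    FormalMultilinearSeries.apply_eq_pow_smul_coeff, Polynomial.eval_mul, Polynomial.eval_C,
    Polynomial.eval_pow, Polynomial.eval_X, smul_eq_mul, mul_comm]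

lemma circleAverage_sq_norm_mono {f : ℂ → ℂ} {ρ r R : ℝ}
    (hf : DifferentiableOn ℂ f (Metric.ball 0 ρ)) (hr : 0 ≤ r) (hrR : r ≤ R) (hRρ : R < ρ) :
    circleAverage (fun z => ‖f z‖ ^ 2) 0 r ≤ circleAverage (fun z => ‖f z‖ ^ 2) 0 R := by
  obtain ⟨q, hq⟩ := exists_polynomial_tendstoUniformlyOn hRρ hf
  have htendsto : ∀ t, 0 ≤ t → t ≤ R →
      Tendsto (fun n => circleAverage (fun z => ‖(q n).eval z‖ ^ 2) 0 t) atTop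
        (𝓝 (circleAverage (fun z => ‖f z‖ ^ 2) 0 t)) := fun t ht htR => by
    have hsub : Metric.sphere (0 : ℂ) |t| ⊆ Metric.closedBall 0 R := by
      rw [abs_of_nonneg ht]
      exact Metric.sphere_subset_closedBall.trans (Metric.closedBall_subset_closedBall htR)
    exact tendsto_circleAverage_sq_norm (fun n => (q n).continuous)
      (hf.continuousOn.mono (hsub.trans (Metric.closedBall_subset_ball hRρ))) (hq.mono hsub)
  refine le_of_tendsto_of_tendsto' (htendsto r hr hrR) (htendsto R (hr.trans hrR) le_rfl)
    fun n => ?_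
  simp only [circleAverage_polynomial_sq_norm, Polynomial.sum_def]
  gcongr

lemma circleAverage_eq_of_differentiableOn_ball {E : Type*} [NormedAddCommGroup E]
    [NormedSpace ℂ E] [CompleteSpace E] {f : ℂ → E} {c : ℂ} {r R : ℝ}
    (hf : DifferentiableOn ℂ f (Metric.ball c R)) (hr : 0 ≤ r) (hrR : r < R) :
    circleAverage f c r = f c := by
  apply DiffContOnCl.circleAverage
  rw [abs_of_nonneg hr]
  exact hf.diffContOnCl_ball (Metric.closedBall_subset_ball hrR)

lemma integrableOn_ball_of_continuousOn {f : ℂ → ℝ} {c : ℂ} {r R : ℝ}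
    (hf : ContinuousOn f (Metric.ball c R)) (hrR : r < R) : IntegrableOn f (Metric.ball c r) :=
  ((hf.mono (Metric.closedBall_subset_ball hrR)).integrableOn_compact
    (isCompact_closedBall _ _)).mono_set Metric.ball_subset_closedBall

lemma sq_norm_mul_le_setIntegral_ball_zero {f : ℂ → ℂ} {δ ρ : ℝ} (hδ : 0 ≤ δ) (hδρ : δ < ρ)
    (hf : DifferentiableOn ℂ f (Metric.ball 0 ρ)) :
    π * δ ^ 2 * ‖f 0‖ ^ 2 ≤ ∫ z in Metric.ball 0 δ, ‖f z‖ ^ 2 := by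
  have hint : IntegrableOn (fun z => ‖f z‖ ^ 2) (Metric.ball 0 δ) :=
    integrableOn_ball_of_continuousOn (hf.continuousOn.norm.pow 2) hδρ
  have hconst : ∫ r in Set.Ioo 0 δ, 2 * π * r * ‖f 0‖ ^ 2 = π * δ ^ 2 * ‖f 0‖ ^ 2 := by
    rw [← integral_Ioc_eq_integral_Ioo, ← intervalIntegral.integral_of_le hδ,
      intervalIntegral.integral_mul_const, intervalIntegral.integral_const_mul, integral_id]
    ring
  rw [← hconst, setIntegral_ball_eq_integral_circleAverage hint]
  refine setIntegral_mono_on (IntegrableOn.mono_set (Continuous.integrableOn_Icc (by fun_prop))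
    Set.Ioo_subset_Icc_self) (integrableOn_Ioo_circleAverage hint) measurableSet_Ioo
    fun r hr => ?_
  have hmono := circleAverage_sq_norm_mono hf le_rfl hr.1.le (hr.2.trans hδρ)
  rw [circleAverage_zero] at hmono
  exact mul_le_mul_of_nonneg_left hmono (mul_nonneg two_pi_pos.le hr.1.le)

lemma sq_norm_mul_le_setIntegral_ball {f : ℂ → ℂ} {c : ℂ} {δ ρ : ℝ} (hδ : 0 ≤ δ) (hδρ : δ < ρ)
    (hf : DifferentiableOn ℂ f (Metric.ball c ρ)) :
    π * δ ^ 2 * ‖f c‖ ^ 2 ≤ ∫ z in Metric.ball c δ, ‖f z‖ ^ 2 := by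
  have hmaps : Set.MapsTo (fun z => c + z) (Metric.ball 0 ρ) (Metric.ball c ρ) := fun z hz => by
    simpa using hz
  have h := sq_norm_mul_le_setIntegral_ball_zero hδ hδρ (hf.comp (by fun_prop) hmaps)
  have htranslate := (measurePreserving_add_left volume c).setIntegral_preimage_emb
    (measurableEmbedding_addLeft c) (fun z => ‖f z‖ ^ 2) (Metric.ball c δ)
  rw [preimage_add_ball, sub_self] at htranslate
  simpa [htranslate] using h

end CircleMeans

section Weight

/-- The weight `(1 - |z|²)^β`. -/
def weight (β : ℝ) (z : ℂ) : ℝ := (1 - ‖z‖ ^ 2) ^ β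

lemma isOpen_disk : IsOpen disk := Metric.isOpen_ball

lemma measurableSet_disk : MeasurableSet disk := measurableSet_ball

lemma mem_disk_iff {z : ℂ} : z ∈ disk ↔ ‖z‖ < 1 := mem_ball_zero_iff

lemma closedBall_subset_disk {R : ℝ} (hR : R < 1) : Metric.closedBall 0 R ⊆ disk :=
  Metric.closedBall_subset_ball hR

lemma one_sub_sq_pos {r : ℝ} (hr0 : 0 ≤ r) (hr1 : r < 1) : 0 < 1 - r ^ 2 :=
  sub_pos.2 (pow_lt_one₀ hr0 hr1 two_ne_zero)

lemma one_sub_sq_norm_pos {z : ℂ} (hz : z ∈ disk) : 0 < 1 - ‖z‖ ^ 2 :=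
  one_sub_sq_pos (norm_nonneg z) (mem_disk_iff.1 hz)

lemma weight_pos (β : ℝ) {z : ℂ} (hz : z ∈ disk) : 0 < weight β z :=
  rpow_pos_of_pos (one_sub_sq_norm_pos hz) _

lemma weight_add (β γ : ℝ) {z : ℂ} (hz : z ∈ disk) :
    weight (β + γ) z = weight β z * weight γ z :=
  rpow_add (one_sub_sq_norm_pos hz) _ _

lemma continuousOn_weight (β : ℝ) : ContinuousOn (weight β) disk :=
  ContinuousOn.rpow_const (by fun_prop) fun _ hz => Or.inl (one_sub_sq_norm_pos hz).ne'

lemma min_rpow_mul_rpow_le_rpow {a b x y : ℝ} (β : ℝ) (ha : 0 < a) (hb : 0 < b) (hx : 0 < x)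
    (hay : a * x ≤ y) (hyb : y ≤ b * x) : min (a ^ β) (b ^ β) * x ^ β ≤ y ^ β := by
  have hy : 0 < y := (mul_pos ha hx).trans_le hay
  rcases le_total 0 β with hβ | hβ
  · calc min (a ^ β) (b ^ β) * x ^ β ≤ a ^ β * x ^ β := by gcongr; exact min_le_left _ _
      _ = (a * x) ^ β := (mul_rpow ha.le hx.le).symm
      _ ≤ y ^ β := by gcongr
  · calc min (a ^ β) (b ^ β) * x ^ β ≤ b ^ β * x ^ β := by gcongr; exact min_le_right _ _
      _ = (b * x) ^ β := (mul_rpow hb.le hx.le).symm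
      _ ≤ y ^ β := rpow_le_rpow_of_nonpos hy hyb hβ

lemma ball_subset_disk {z : ℂ} (hz : z ∈ disk) :
    Metric.ball z ((1 - ‖z‖ ^ 2) / 2) ⊆ disk := fun w hw => by
  rw [mem_disk_iff] at hz ⊢
  rw [Metric.mem_ball, dist_eq_norm] at hw
  nlinarith [norm_nonneg z, norm_le_norm_add_norm_sub' w z]

lemma one_sub_sq_norm_comparable {z w : ℂ} (hz : z ∈ disk)
    (hw : w ∈ Metric.ball z ((1 - ‖z‖ ^ 2) / 4)) :
    4⁻¹ * (1 - ‖z‖ ^ 2) ≤ 1 - ‖w‖ ^ 2 ∧ 1 - ‖w‖ ^ 2 ≤ 2 * (1 - ‖z‖ ^ 2) := by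
  rw [mem_disk_iff] at hz
  rw [Metric.mem_ball, dist_eq_norm] at hw
  have hupper := norm_le_norm_add_norm_sub' w z
  have hlower := norm_sub_norm_le z w
  rw [norm_sub_rev] at hlower
  have hz0 := norm_nonneg z
  have hw0 := norm_nonneg w
  constructor <;> nlinarith [sq_nonneg (‖w‖ - ‖z‖)]

lemma exists_growth_bound {α : ℝ} {g : ℂ → ℂ} (hg : g ∈ space α) :
    ∃ C, ∀ z ∈ disk, ‖g z‖ ^ 2 * weight (α + 2) z ≤ C := by
  set T := ∫ z in disk, ‖g z‖ ^ 2 * weight α z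
  have hnonneg : ∀ z ∈ disk, 0 ≤ ‖g z‖ ^ 2 * weight α z := fun z hz =>
    mul_nonneg (sq_nonneg _) (weight_pos α hz).le
  set m : ℝ := min ((4⁻¹ : ℝ) ^ α) (2 ^ α)
  have : 0 < m := lt_min (by positivity) (by positivity)
  refine ⟨16 * T / (π * m), fun z hz => ?_⟩
  set D := 1 - ‖z‖ ^ 2
  have hD : 0 < D := one_sub_sq_norm_pos hz
  have hquarter_subset : Metric.ball z (D / 4) ⊆ disk :=
    (Metric.ball_subset_ball (by linarith)).trans (ball_subset_disk hz)
  have hdiff : DifferentiableOn ℂ g (Metric.ball z (D / 2)) := hg.1.mono (ball_subset_disk hz)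
  have hmean := sq_norm_mul_le_setIntegral_ball (by positivity)
    (show D / 4 < D / 2 by linarith) hdiff
  have hint : IntegrableOn (fun w => ‖g w‖ ^ 2) (Metric.ball z (D / 4)) :=
    integrableOn_ball_of_continuousOn (hdiff.continuousOn.norm.pow 2) (by linarith)
  have hweighted : m * D ^ α * ∫ w in Metric.ball z (D / 4), ‖g w‖ ^ 2 ≤ T := by
    rw [← integral_const_mul]
    refine (setIntegral_mono_on (hint.const_mul _) (hg.2.mono_set hquarter_subset)
      measurableSet_ball fun w hw => ?_).trans (setIntegral_mono_set hg.2
        ((ae_restrict_iff' measurableSet_disk).2 (ae_of_all _ hnonneg))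
        hquarter_subset.eventuallyLE)
    obtain ⟨hlower, hupper⟩ := one_sub_sq_norm_comparable hz hw
    rw [mul_comm]
    exact mul_le_mul_of_nonneg_left
      (min_rpow_mul_rpow_le_rpow α (by norm_num) two_pos hD hlower hupper) (sq_nonneg _)
  rw [le_div_iff₀ (by positivity), weight, rpow_add hD, rpow_two]
  calc ‖g z‖ ^ 2 * (D ^ α * D ^ 2) * (π * m)
      = 16 * (m * D ^ α * (π * (D / 4) ^ 2 * ‖g z‖ ^ 2)) := by ring
    _ ≤ 16 * (m * D ^ α * ∫ w in Metric.ball z (D / 4), ‖g w‖ ^ 2) := by gcongr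
    _ ≤ 16 * T := by gcongr

end Weight

section RadialIntegrals

lemma integrableOn_and_integral_Ioo_of_hasDerivAt {F f : ℝ → ℝ} {a b : ℝ} (hab : a ≤ b)
    (hcont : ContinuousOn F (Set.Icc a b)) (hderiv : ∀ x ∈ Set.Ioo a b, HasDerivAt F (f x) x)
    (hf : ∀ x ∈ Set.Ioo a b, 0 ≤ f x) :
    IntegrableOn f (Set.Ioo a b) ∧ ∫ x in Set.Ioo a b, f x = F b - F a := by
  have hint := intervalIntegral.integrableOn_deriv_of_nonneg hcont hderiv hf
  refine ⟨hint.mono_set Set.Ioo_subset_Ioc_self, ?_⟩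
  rw [← integral_Ioc_eq_integral_Ioo, ← intervalIntegral.integral_of_le hab]
  exact intervalIntegral.integral_eq_sub_of_hasDerivAt_of_le hab hcont hderiv
    ((intervalIntegrable_iff_integrableOn_Ioc_of_le hab).2 hint)

lemma hasDerivAt_one_sub_sq (r : ℝ) : HasDerivAt (fun r : ℝ => 1 - r ^ 2) (-(2 * r)) r := by
  simpa using (hasDerivAt_pow 2 r).const_sub 1

lemma hasDerivAt_one_sub_sq_rpow (β : ℝ) {r : ℝ} (hr : 0 < 1 - r ^ 2) :
    HasDerivAt (fun r : ℝ => (1 - r ^ 2) ^ β) (-(2 * r) * β * (1 - r ^ 2) ^ (β - 1)) r :=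
  (hasDerivAt_one_sub_sq r).rpow_const (Or.inl hr.ne')

lemma continuous_one_sub_sq_rpow {β : ℝ} (hβ : 0 ≤ β) :
    Continuous (fun r : ℝ => (1 - r ^ 2) ^ β) :=
  Continuous.rpow_const (by fun_prop) fun _ => Or.inr hβ

lemma integral_Ioo_mul_one_sub_sq_rpow {α : ℝ} (hα : -1 < α) {ρ : ℝ} (hρ0 : 0 ≤ ρ) (hρ1 : ρ ≤ 1) :
    IntegrableOn (fun r : ℝ => r * (1 - r ^ 2) ^ α) (Set.Ioo 0 ρ) ∧
      ∫ r in Set.Ioo 0 ρ, r * (1 - r ^ 2) ^ α = (1 - (1 - ρ ^ 2) ^ (α + 1)) / (2 * (α + 1)) := by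
  have hα1 : α + 1 ≠ 0 := by linarith
  have hpos : ∀ r ∈ Set.Ioo 0 ρ, 0 < 1 - r ^ 2 := fun r hr =>
    one_sub_sq_pos hr.1.le (hr.2.trans_le hρ1)
  have h := integrableOn_and_integral_Ioo_of_hasDerivAt
    (F := fun r => -((1 - r ^ 2) ^ (α + 1) / (2 * (α + 1)))) (f := fun r => r * (1 - r ^ 2) ^ α) hρ0
    ((continuous_one_sub_sq_rpow (by linarith)).div_const _).neg.continuousOn
    (fun r hr => by
      convert! ((hasDerivAt_one_sub_sq_rpow (α + 1) (hpos r hr)).div_const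
        (2 * (α + 1))).neg using 1
      rw [add_sub_cancel_right]
      field_simp)
    (fun r hr => mul_nonneg hr.1.le (rpow_nonneg (hpos r hr).le _))
  refine ⟨h.1, h.2.trans ?_⟩
  rw [zero_pow two_ne_zero, sub_zero, one_rpow]
  ring

lemma integral_Ioo_pow_five_mul_one_sub_sq_rpow {α : ℝ} (hα : -1 < α) {ρ : ℝ} (hρ0 : 0 ≤ ρ)
    (hρ1 : ρ ≤ 1) :
    IntegrableOn (fun r : ℝ => r ^ 5 * (1 - r ^ 2) ^ α) (Set.Ioo 0 ρ) ∧
      ∫ r in Set.Ioo 0 ρ, r ^ 5 * (1 - r ^ 2) ^ α =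
        (1 - (1 - ρ ^ 2) ^ (α + 1) *
          (1 + (α + 1) * ρ ^ 2 + (α + 1) * (α + 2) / 2 * ρ ^ 4)) /
          ((α + 1) * (α + 2) * (α + 3)) := by
  have hα1 : α + 1 ≠ 0 := by linarith
  have hα2 : α + 2 ≠ 0 := by linarith
  have hα3 : α + 3 ≠ 0 := by linarith
  have hpos : ∀ r ∈ Set.Ioo 0 ρ, 0 < 1 - r ^ 2 := fun r hr =>
    one_sub_sq_pos hr.1.le (hr.2.trans_le hρ1)
  have hpoly : ∀ r, HasDerivAt
      (fun r : ℝ => 1 + (α + 1) * r ^ 2 + (α + 1) * (α + 2) / 2 * r ^ 4)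
      (2 * (α + 1) * r + 2 * (α + 1) * (α + 2) * r ^ 3) r := fun r => by
    convert! (((hasDerivAt_pow 2 r).const_mul (α + 1)).const_add 1).add
      ((hasDerivAt_pow 4 r).const_mul ((α + 1) * (α + 2) / 2)) using 1
    norm_num
    ring
  have h := integrableOn_and_integral_Ioo_of_hasDerivAt
    (F := fun r => -((1 - r ^ 2) ^ (α + 1) *
      (1 + (α + 1) * r ^ 2 + (α + 1) * (α + 2) / 2 * r ^ 4) / ((α + 1) * (α + 2) * (α + 3))))
    (f := fun r => r ^ 5 * (1 - r ^ 2) ^ α) hρ0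
    (((continuous_one_sub_sq_rpow (by linarith)).mul (by fun_prop)).div_const _).neg.continuousOn
    (fun r hr => by
      convert! (((hasDerivAt_one_sub_sq_rpow (α + 1) (hpos r hr)).mul (hpoly r)).div_const
        ((α + 1) * (α + 2) * (α + 3))).neg using 1
      rw [add_sub_cancel_right, rpow_add_one (hpos r hr).ne']
      field_simp
      ring)
    (fun r hr => mul_nonneg (pow_nonneg hr.1.le 5) (rpow_nonneg (hpos r hr).le _))
  refine ⟨h.1, h.2.trans ?_⟩
  simp only [ne_eq, OfNat.ofNat_ne_zero, not_false_eq_true, zero_pow, sub_zero, one_rpow]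
  ring

lemma setIntegral_ball_radial {w : ℝ → ℝ} {ρ : ℝ}
    (hw : IntegrableOn (fun z : ℂ => w ‖z‖) (Metric.ball 0 ρ)) :
    ∫ z in Metric.ball (0 : ℂ) ρ, w ‖z‖ = 2 * π * ∫ r in Set.Ioo 0 ρ, r * w r := by
  rw [setIntegral_ball_eq_integral_circleAverage hw, ← integral_const_mul]
  refine setIntegral_congr_fun measurableSet_Ioo fun r hr => ?_
  have h := circleAverage_radial_smul (fun _ => (1 : ℝ)) w hr.1.le
  simp only [smul_eq_mul, mul_one, circleAverage_const] at h
  simp only [h, smul_eq_mul, mul_assoc]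

lemma integrableOn_weight {α : ℝ} (hα : -1 < α) : IntegrableOn (weight α) disk :=
  (integrableOn_fun_norm_addHaar (E := ℂ) volume (f := fun r : ℝ => (1 - r ^ 2) ^ α)
    (r := 1)).2 (by simpa using (integral_Ioo_mul_one_sub_sq_rpow hα zero_le_one le_rfl).1)

lemma integral_weight_ball {α : ℝ} (hα : -1 < α) {ρ : ℝ} (hρ0 : 0 ≤ ρ) (hρ1 : ρ ≤ 1) :
    ∫ z in Metric.ball 0 ρ, weight α z = π * (1 - (1 - ρ ^ 2) ^ (α + 1)) / (α + 1) := by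
  have hα1 : α + 1 ≠ 0 := by linarith
  refine (setIntegral_ball_radial (w := fun r => (1 - r ^ 2) ^ α)
    ((integrableOn_weight hα).mono_set (Metric.ball_subset_ball hρ1))).trans ?_
  rw [(integral_Ioo_mul_one_sub_sq_rpow hα hρ0 hρ1).2]
  field_simp

lemma integral_weight_disk {α : ℝ} (hα : -1 < α) : ∫ z in disk, weight α z = π / (α + 1) := by
  rw [disk, integral_weight_ball hα zero_le_one le_rfl, one_pow, sub_self,
    zero_rpow (by linarith), sub_zero, mul_one]

end RadialIntegrals

section Orthogonality

lemma setIntegral_Ioo_pos {f : ℝ → ℝ} {a b : ℝ} (hab : a < b) (hint : IntegrableOn f (Set.Ioo a b))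
    (hf : ∀ x ∈ Set.Ioo a b, 0 < f x) : 0 < ∫ x in Set.Ioo a b, f x := by
  rw [← integral_Ioc_eq_integral_Ioo, ← intervalIntegral.integral_of_le hab.le]
  exact intervalIntegral.intervalIntegral_pos_of_pos_on
    ((intervalIntegrable_iff_integrableOn_Ioo_of_le hab.le).2 hint) hf hab

lemma eq_zero_of_setIntegral_radial_smul_eq_zero {q : ℂ → ℂ} {w : ℝ → ℝ} {ρ : ℝ} (hρ : 0 < ρ)
    (hq : DifferentiableOn ℂ q (Metric.ball 0 ρ)) (hw : ∀ r ∈ Set.Ioo 0 ρ, 0 < w r)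
    (hint : IntegrableOn (fun z => w ‖z‖ • q z) (Metric.ball 0 ρ))
    (hzero : ∫ z in Metric.ball 0 ρ, w ‖z‖ • q z = 0) : q 0 = 0 := by
  have hmean : ∀ r ∈ Set.Ioo 0 ρ,
      (2 * π * r) • circleAverage (fun z => w ‖z‖ • q z) 0 r = (2 * π * r * w r) • q 0 := by
    intro r hr
    rw [circleAverage_radial_smul q w hr.1.le,
      circleAverage_eq_of_differentiableOn_ball hq hr.1.le hr.2, smul_smul]
  rw [setIntegral_ball_eq_integral_circleAverage hint,
    setIntegral_congr_fun measurableSet_Ioo hmean, integral_smul_const, smul_eq_zero] at hzero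
  by_contra hq0
  have hint_radial : IntegrableOn (fun r => 2 * π * r * w r) (Set.Ioo 0 ρ) :=
    (integrable_smul_const hq0).1
      ((integrableOn_Ioo_circleAverage hint).congr_fun hmean measurableSet_Ioo)
  exact (setIntegral_Ioo_pos hρ hint_radial fun r hr =>
    mul_pos (mul_pos two_pi_pos hr.1) (hw r hr)).ne' (hzero.resolve_right hq0)

lemma integrableOn_weight_smul {α : ℝ} (hα : -1 < α) {g : ℂ → ℂ} (hg : g ∈ space α) {h : ℂ → ℂ}
    (hcont : ContinuousOn h disk) (hle : ∀ z ∈ disk, ‖h z‖ ≤ ‖g z‖) :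
    IntegrableOn (fun z => weight α z • h z) disk := by
  have hdom : IntegrableOn (fun z => ‖g z‖ ^ 2 * weight α z + weight α z) disk :=
    hg.2.add (integrableOn_weight hα)
  refine hdom.mono' (((continuousOn_weight α).smul hcont).aestronglyMeasurable
    measurableSet_disk) ((ae_restrict_iff' measurableSet_disk).2 (ae_of_all _ fun z hz => ?_))
  have hw := weight_pos α hz
  rw [norm_smul, Real.norm_of_nonneg hw.le, ← add_one_mul, mul_comm]
  gcongr
  nlinarith [hle z hz, sq_nonneg (‖g z‖ - 1), norm_nonneg (g z)]

lemma eq_mul_dslope {f : ℂ → ℂ} (hf : f 0 = 0) (z : ℂ) : f z = z * dslope f 0 z := by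
  simpa [hf] using (sub_smul_dslope f 0 z).symm

lemma scalar_one_right (α : ℝ) (g : ℂ → ℂ) :
    scalar α g (fun _ => 1) = ∫ z in disk, weight α z • g z := by
  simp only [scalar, weight, map_one, mul_one, Complex.real_smul, mul_comm]

lemma apply_zero_eq_zero_of_scalar_one {α : ℝ} (hα : -1 < α) {g : ℂ → ℂ} (hg : g ∈ space α)
    (hg_one : scalar α g (fun _ => 1) = 0) : g 0 = 0 :=
  eq_zero_of_setIntegral_radial_smul_eq_zero one_pos hg.1 (w := fun r => (1 - r ^ 2) ^ α)
    (fun _ hr => rpow_pos_of_pos (one_sub_sq_pos hr.1.le hr.2) _)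
    (integrableOn_weight_smul hα hg hg.1.continuousOn fun _ _ => le_rfl)
    ((scalar_one_right α g).symm.trans hg_one)

lemma dslope_zero_eq_zero_of_scalar_id {α : ℝ} (hα : -1 < α) {g : ℂ → ℂ} (hg : g ∈ space α)
    (hg0 : g 0 = 0) (hg_id : scalar α g (fun z => z) = 0) : dslope g 0 0 = 0 := by
  have hconj : ∀ z, weight α z • (g z * (starRingEnd ℂ) z) =
      (‖z‖ ^ 2 * (1 - ‖z‖ ^ 2) ^ α) • dslope g 0 z := fun z => by
    rw [eq_mul_dslope hg0 z, mul_right_comm, Complex.mul_conj, Complex.normSq_eq_norm_sq,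
      ← Complex.real_smul, smul_smul, mul_comm, weight]
  have hint := integrableOn_weight_smul (h := fun z => g z * (starRingEnd ℂ) z) hα hg
    (hg.1.continuousOn.mul Complex.continuous_conj.continuousOn) fun z hz => by
      rw [norm_mul, RCLike.norm_conj]
      exact mul_le_of_le_one_right (norm_nonneg _) (mem_disk_iff.1 hz).le
  simp only [hconj] at hint
  refine eq_zero_of_setIntegral_radial_smul_eq_zero one_pos
    ((Complex.differentiableOn_dslope (isOpen_disk.mem_nhds (by simp [disk]))).2 hg.1)
    (w := fun r => r ^ 2 * (1 - r ^ 2) ^ α)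
    (fun r hr => mul_pos (pow_pos hr.1 2) (rpow_pos_of_pos (one_sub_sq_pos hr.1.le hr.2) _))
    hint (Eq.trans ?_ hg_id)
  simp only [← hconj, scalar, weight, Complex.real_smul, mul_comm, disk]

lemma exists_eq_sq_mul {α : ℝ} (hα : -1 < α) {g : ℂ → ℂ} (hg : g ∈ space α)
    (hg_one : scalar α g (fun _ => 1) = 0) (hg_id : scalar α g (fun z => z) = 0) :
    ∃ h : ℂ → ℂ, DifferentiableOn ℂ h disk ∧ ∀ z, g z = z ^ 2 * h z := by
  have hdisk : disk ∈ 𝓝 (0 : ℂ) := isOpen_disk.mem_nhds (by simp [disk])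
  have hg0 := apply_zero_eq_zero_of_scalar_one hα hg hg_one
  have hslope := dslope_zero_eq_zero_of_scalar_id hα hg hg0 hg_id
  refine ⟨dslope (dslope g 0) 0, (Complex.differentiableOn_dslope hdisk).2
    ((Complex.differentiableOn_dslope hdisk).2 hg.1), fun z => ?_⟩
  rw [pow_two, mul_assoc, ← eq_mul_dslope hslope, ← eq_mul_dslope hg0]

end Orthogonality

section Perturbation

/-- The value `√((α + 1) / π)` of the constant function `f₀`. -/
def c₀ (α : ℝ) : ℝ := √((α + 1) / π)

lemma c₀_pos {α : ℝ} (hα : -1 < α) : 0 < c₀ α :=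
  sqrt_pos.2 (div_pos (by linarith) pi_pos)

lemma c₀_sq {α : ℝ} (hα : -1 < α) : c₀ α ^ 2 = (α + 1) / π :=
  sq_sqrt (div_pos (by linarith) pi_pos).le

/-- The perturbation `f₀ + ε g` of the constant function. -/
def pert (α : ℝ) (g : ℂ → ℂ) (ε : ℝ) (z : ℂ) : ℂ := f₀ α z + (ε : ℂ) * g z

lemma sq_norm_pert (α : ℝ) (g : ℂ → ℂ) (ε : ℝ) (z : ℂ) :
    ‖pert α g ε z‖ ^ 2 = c₀ α ^ 2 + 2 * c₀ α * ε * (g z).re + ε ^ 2 * ‖g z‖ ^ 2 := by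
  rw [← Complex.normSq_eq_norm_sq, ← Complex.normSq_eq_norm_sq, Complex.normSq_apply,
    Complex.normSq_apply]
  simp only [pert, f₀, c₀, Complex.add_re, Complex.ofReal_re, Complex.mul_re, Complex.ofReal_im,
    zero_mul, sub_zero, Complex.add_im, Complex.mul_im, add_zero, zero_add]
  ring

lemma norm_sq (α : ℝ) (f : ℂ → ℂ) : norm α f ^ 2 = ∫ z in disk, ‖f z‖ ^ 2 * weight α z :=
  sq_sqrt (setIntegral_nonneg measurableSet_disk fun _ hz =>
    mul_nonneg (sq_nonneg _) (weight_pos α hz).le)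

lemma norm_sq_pert {α : ℝ} (hα : -1 < α) {g : ℂ → ℂ} (hg : g ∈ space α)
    (hg_one : scalar α g (fun _ => 1) = 0) (ε : ℝ) :
    norm α (pert α g ε) ^ 2 = 1 + ε ^ 2 * norm α g ^ 2 := by
  have hint := integrableOn_weight_smul hα hg hg.1.continuousOn fun _ _ => le_rfl
  have hint_re : IntegrableOn (fun z => (weight α z • g z).re) disk :=
    Complex.reCLM.integrable_comp hint
  have hre : ∫ z in disk, (weight α z • g z).re = 0 := by
    have hcomm := Complex.reCLM.integral_comp_comm hint
    rw [← scalar_one_right, hg_one, map_zero] at hcomm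
    exact hcomm
  have hα1 : α + 1 ≠ 0 := by linarith
  have hexpand : ∀ z, ‖pert α g ε z‖ ^ 2 * weight α z = c₀ α ^ 2 * weight α z +
      2 * c₀ α * ε * (weight α z • g z).re + ε ^ 2 * (‖g z‖ ^ 2 * weight α z) := fun z => by
    rw [sq_norm_pert, Complex.smul_re, smul_eq_mul]
    ring
  have hint_const := (integrableOn_weight hα).const_mul (c₀ α ^ 2)
  have hint_linear := hint_re.const_mul (2 * c₀ α * ε)
  have hint_sum : IntegrableOn (fun z => c₀ α ^ 2 * weight α z +
      2 * c₀ α * ε * (weight α z • g z).re) disk := hint_const.add hint_linear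
  have hint_sq : IntegrableOn (fun z => ε ^ 2 * (‖g z‖ ^ 2 * weight α z)) disk :=
    Integrable.const_mul hg.2 (ε ^ 2)
  rw [norm_sq, norm_sq, integral_congr_ae (ae_of_all _ hexpand), integral_add hint_sum hint_sq,
    integral_add hint_const hint_linear]
  simp only [integral_const_mul, hre, integral_weight_disk hα, c₀_sq hα]
  field_simp
  ring

end Perturbation

section Rearrangement

open scoped ENNReal

variable {X : Type*} [MeasurableSpace X] {μ : Measure X}

lemma measure_superlevel_sInf_le (f : X → ℝ) (D : Set X) {c : ℝ≥0∞}
    (hne : {t : ℝ | 0 ≤ t ∧ μ {x | x ∈ D ∧ t < f x} ≤ c}.Nonempty) :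
    μ {x | x ∈ D ∧ sInf {t : ℝ | 0 ≤ t ∧ μ {x | x ∈ D ∧ t < f x} ≤ c} < f x} ≤ c := by
  set t := sInf {t : ℝ | 0 ≤ t ∧ μ {x | x ∈ D ∧ t < f x} ≤ c}
  obtain ⟨δ, hδ_anti, hδ_pos, hδ_lim⟩ := exists_seq_strictAnti_tendsto (0 : ℝ)
  have hmono : Monotone fun n => {x | x ∈ D ∧ t + δ n < f x} := fun m n hmn x hx =>
    ⟨hx.1, (add_le_add_right (hδ_anti.antitone hmn) t).trans_lt hx.2⟩
  have hunion : {x | x ∈ D ∧ t < f x} = ⋃ n, {x | x ∈ D ∧ t + δ n < f x} := by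
    ext x
    simp only [Set.mem_iUnion]
    refine ⟨fun hx => ?_, fun ⟨n, hx⟩ => ⟨hx.1, (lt_add_of_pos_right t (hδ_pos n)).trans hx.2⟩⟩
    obtain ⟨n, hn⟩ := (hδ_lim.eventually (gt_mem_nhds (sub_pos.2 hx.2))).exists
    exact ⟨n, hx.1, lt_sub_iff_add_lt'.1 hn⟩
  rw [hunion]
  refine le_of_tendsto' (tendsto_measure_iUnion_atTop hmono) fun n => ?_
  obtain ⟨t', ht', hlt⟩ := exists_lt_of_csInf_lt hne (lt_add_of_pos_right t (hδ_pos n))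
  refine (measure_mono ?_).trans ht'.2
  exact fun x hx => ⟨hx.1, hlt.trans hx.2⟩

lemma le_measure_superlevel_sInf {f : X → ℝ} {D : Set X} {c : ℝ≥0∞} {t₁ : ℝ} (ht₁ : 0 ≤ t₁)
    (hlt : t₁ < sInf {t : ℝ | 0 ≤ t ∧ μ {x | x ∈ D ∧ t < f x} ≤ c})
    (hmeas : ∀ t, MeasurableSet {x | x ∈ D ∧ t < f x})
    (hfin : μ {x | x ∈ D ∧ t₁ < f x} ≠ ⊤)
    (hnull : μ {x | x ∈ D ∧ f x = sInf {t : ℝ | 0 ≤ t ∧ μ {x | x ∈ D ∧ t < f x} ≤ c}} = 0) :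
    c ≤ μ {x | x ∈ D ∧ sInf {t : ℝ | 0 ≤ t ∧ μ {x | x ∈ D ∧ t < f x} ≤ c} < f x} := by
  set T := {t : ℝ | 0 ≤ t ∧ μ {x | x ∈ D ∧ t < f x} ≤ c}
  have hbdd : BddBelow T := ⟨0, fun _ ht => ht.1⟩
  obtain ⟨τ, hτ_mono, hτ_mem, hτ_lim⟩ := exists_seq_strictMono_tendsto' hlt
  have hanti : Antitone fun n => {x | x ∈ D ∧ τ n < f x} := fun m n hmn x hx =>
    ⟨hx.1, (hτ_mono.monotone hmn).trans_lt hx.2⟩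
  have hsub₀ : {x | x ∈ D ∧ τ 0 < f x} ⊆ {x | x ∈ D ∧ t₁ < f x} := fun x hx =>
    ⟨hx.1, (hτ_mem 0).1.trans hx.2⟩
  have hfin₀ : μ {x | x ∈ D ∧ τ 0 < f x} ≠ ⊤ := measure_ne_top_of_subset hsub₀ hfin
  have hle : c ≤ μ (⋂ n, {x | x ∈ D ∧ τ n < f x}) := by
    refine ge_of_tendsto' (tendsto_measure_iInter_atTop (fun n => (hmeas _).nullMeasurableSet)
      hanti ⟨0, hfin₀⟩) fun n => le_of_not_ge fun hcon => ?_
    have hmem : τ n ∈ T := ⟨ht₁.trans (hτ_mem n).1.le, hcon⟩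
    exact (csInf_le hbdd hmem).not_gt (hτ_mem n).2
  have hsub : ⋂ n, {x | x ∈ D ∧ τ n < f x} ⊆
      {x | x ∈ D ∧ sInf T < f x} ∪ {x | x ∈ D ∧ f x = sInf T} := fun x hx => by
    rw [Set.mem_iInter] at hx
    rcases (le_of_tendsto' hτ_lim fun n => (hx n).2.le).lt_or_eq with h | h
    · exact Or.inl ⟨(hx 0).1, h⟩
    · exact Or.inr ⟨(hx 0).1, h.symm⟩
  calc c ≤ μ (⋂ n, {x | x ∈ D ∧ τ n < f x}) := hle
    _ ≤ μ ({x | x ∈ D ∧ sInf T < f x} ∪ {x | x ∈ D ∧ f x = sInf T}) := measure_mono hsub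
    _ ≤ μ {x | x ∈ D ∧ sInf T < f x} + μ {x | x ∈ D ∧ f x = sInf T} := measure_union_le _ _
    _ = μ {x | x ∈ D ∧ sInf T < f x} := by rw [hnull, add_zero]

lemma setIntegral_le_setIntegral_of_bathtub {A B : Set X} {v : X → ℝ} {t : ℝ}
    (hA : MeasurableSet A) (hB : MeasurableSet B) (hAt : ∀ x ∈ A, t ≤ v x)
    (hBt : ∀ x ∈ B, x ∉ A → v x ≤ t) (hAB : μ A = μ B) (hfin : μ A ≠ ⊤)
    (hvA : IntegrableOn v A μ) (hvB : IntegrableOn v B μ) :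
    ∫ x in B, v x ∂μ ≤ ∫ x in A, v x ∂μ := by
  have hcA : IntegrableOn (fun _ => t) A μ := integrableOn_const hfin
  have hcB : IntegrableOn (fun _ => t) B μ := integrableOn_const (hAB ▸ hfin)
  have hsub : ∫ x in B, (v x - t) ∂μ ≤ ∫ x in A, (v x - t) ∂μ := by
    rw [← integral_indicator hA, ← integral_indicator hB]
    refine integral_mono ((integrable_indicator_iff hB).2 (hvB.sub hcB))
      ((integrable_indicator_iff hA).2 (hvA.sub hcA)) fun x => ?_
    by_cases hxB : x ∈ B <;> by_cases hxA : x ∈ A <;>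
      simp only [hxA, hxB, Set.indicator_of_mem, Set.indicator_of_notMem, not_false_eq_true,
        le_refl, sub_nonneg, tsub_le_iff_right, zero_add]
    · exact hBt x hxB hxA
    · exact hAt x hxA
  rw [integral_sub hvA hcA, integral_sub hvB hcB, setIntegral_const, setIntegral_const,
    measureReal_def, measureReal_def, hAB] at hsub
  linarith

lemma norm_setIntegral_sub_le_of_subset {E : Type*} [NormedAddCommGroup E] [NormedSpace ℝ E]
    {A B : Set X} {ψ : X → E} {M : ℝ} (hA : MeasurableSet A) (hAB : A ⊆ B) (hB : μ B ≠ ⊤)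
    (hψ : IntegrableOn ψ B μ) (hM : ∀ x ∈ B, ‖ψ x‖ ≤ M) :
    ‖(∫ x in B, ψ x ∂μ) - ∫ x in A, ψ x ∂μ‖ ≤ M * |μ.real B - μ.real A| := by
  rw [← setIntegral_sdiff hA hψ hAB, ← measureReal_sdiff hAB hA hB,
    abs_of_nonneg measureReal_nonneg]
  exact norm_setIntegral_le_of_norm_le_const
    (measure_lt_top_mono Set.sdiff_subset hB.lt_top) fun x hx => hM x hx.1

lemma tendsto_setIntegral_of_ae_eventually_mem_iff {ι E : Type*} [NormedAddCommGroup E]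
    [NormedSpace ℝ E] {l : Filter ι} [l.IsCountablyGenerated] {ψ : X → E} {B S₀ : Set X}
    {S : ι → Set X} (hψ : IntegrableOn ψ B μ) (hS₀ : MeasurableSet S₀)
    (hS : ∀ i, MeasurableSet (S i)) (hS₀B : S₀ ⊆ B) (hSB : ∀ᶠ i in l, S i ⊆ B)
    (hlim : ∀ᵐ x ∂μ.restrict B, ∀ᶠ i in l, (x ∈ S i ↔ x ∈ S₀)) :
    Tendsto (fun i => ∫ x in S i, ψ x ∂μ) l (𝓝 (∫ x in S₀, ψ x ∂μ)) := by
  have hindicator : ∀ {A : Set X}, MeasurableSet A → A ⊆ B →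
      ∫ x in B, A.indicator ψ x ∂μ = ∫ x in A, ψ x ∂μ := fun hA hAB => by
    rw [setIntegral_indicator hA, Set.inter_eq_right.2 hAB]
  rw [← hindicator hS₀ hS₀B]
  refine Tendsto.congr' (hSB.mono fun i hi => hindicator (hS i) hi) ?_
  refine tendsto_integral_filter_of_dominated_convergence (fun x => ‖ψ x‖)
    (Eventually.of_forall fun i => hψ.aestronglyMeasurable.indicator (hS i))
    (Eventually.of_forall fun i => ae_of_all _ fun x => norm_indicator_le_norm_self _ _) hψ.norm ?_
  filter_upwards [hlim] with x hx
  refine tendsto_const_nhds.congr' (hx.mono fun i hi => ?_)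
  beta_reduce
  by_cases hx₀ : x ∈ S₀
  · rw [Set.indicator_of_mem hx₀, Set.indicator_of_mem (hi.2 hx₀)]
  · rw [Set.indicator_of_notMem hx₀, Set.indicator_of_notMem (mt hi.1 hx₀)]

lemma hasDerivAt_of_subgradient {F D : ℝ → ℝ} {x : ℝ} (hD : ContinuousAt D x)
    (hF : ∀ᶠ y in 𝓝 x, D x * (y - x) ≤ F y - F x ∧ D y * (x - y) ≤ F x - F y) :
    HasDerivAt F (D x) x := by
  rw [hasDerivAt_iff_isLittleO, Asymptotics.isLittleO_iff]
  intro c hc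
  filter_upwards [hF, Metric.tendsto_nhds.1 hD c hc] with y ⟨hlower, hupper⟩ hclose
  rw [Real.dist_eq] at hclose
  have hle : |F y - F x - (y - x) * D x| ≤ |D y - D x| * |y - x| := by
    rw [← abs_mul, abs_of_nonneg (by linarith)]
    exact le_trans (by linarith) (le_abs_self _)
  exact hle.trans (mul_le_mul_of_nonneg_right hclose.le (abs_nonneg _))

end Rearrangement

section MovingBoundary

lemma eventually_lt_iff_of_hasDerivAt {f : ℝ → ℝ} {d : ℝ} (hf : HasDerivAt f d 0) (hd : d ≠ 0) :
    ∀ᶠ ε in 𝓝[≠] (0 : ℝ), (f 0 < f ε ↔ 0 < ε * d) := by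
  have hslope : Tendsto (fun ε => ε⁻¹ * (f ε - f 0) * d) (𝓝[≠] 0) (𝓝 (d * d)) := by
    simpa only [zero_add, smul_eq_mul] using
      (hasDerivAt_iff_tendsto_slope_zero.1 hf).mul_const d
  filter_upwards [hslope.eventually (lt_mem_nhds (mul_self_pos.2 hd)), self_mem_nhdsWithin]
    with ε hpos (hε : ε ≠ 0)
  have hprod : 0 < (f ε - f 0) * (ε * d) := by
    have h := mul_pos (mul_self_pos.2 hε) hpos
    rwa [show ε * ε * (ε⁻¹ * (f ε - f 0) * d) = (f ε - f 0) * (ε * d) by field_simp] at h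
  rw [← sub_pos (a := f ε)]
  exact ⟨fun h => (mul_pos_iff_of_pos_left h).1 hprod,
    fun h => (mul_pos_iff_of_pos_right h).1 hprod⟩

/-- The density, with respect to an ambient measure, of the signed measure `f μ|_A - f μ|_B`; it
vanishes off the symmetric difference of `A` and `B`. -/
def indicatorDiff {X : Type*} (A B : Set X) (f : X → ℝ) (x : X) : ℝ :=
  A.indicator f x - B.indicator f x

lemma indicatorDiff_of_mem_iff {X : Type*} {A B : Set X} {x : X} (f : X → ℝ)
    (h : x ∈ A ↔ x ∈ B) : indicatorDiff A B f x = 0 := by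
  by_cases hx : x ∈ B
  · rw [indicatorDiff, Set.indicator_of_mem (h.2 hx), Set.indicator_of_mem hx, sub_self]
  · rw [indicatorDiff, Set.indicator_of_notMem (mt h.1 hx), Set.indicator_of_notMem hx, sub_self]

lemma abs_indicatorDiff_le {X : Type*} (A B : Set X) (f : X → ℝ) (x : X) :
    |indicatorDiff A B f x| ≤ |f x| := by
  by_cases hA : x ∈ A <;> by_cases hB : x ∈ B <;> simp [indicatorDiff, hA, hB]

lemma indicatorDiff_eq_mul {X Y : Type*} {A B : Set X} {A' B' : Set Y} {x : X} {y : Y}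
    (f : X → ℝ) (hA : x ∈ A ↔ y ∈ A') (hB : x ∈ B ↔ y ∈ B') :
    indicatorDiff A B f x = f x * indicatorDiff A' B' 1 y := by
  by_cases hyA : y ∈ A' <;> by_cases hyB : y ∈ B' <;> simp [indicatorDiff, hA, hB, hyA, hyB]

lemma measurable_indicatorDiff {X : Type*} [TopologicalSpace X] [MeasurableSpace X]
    [OpensMeasurableSpace X] {φ : X → ℝ} {D A B : Set X} (hφ : ContinuousOn φ D)
    (hA : MeasurableSet A) (hB : MeasurableSet B) (hAD : A ⊆ D) (hBD : B ⊆ D) :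
    Measurable (indicatorDiff A B φ) := by
  classical
  have hindicator : ∀ {E}, MeasurableSet E → E ⊆ D → Measurable (E.indicator φ) := fun hE hED => by
    simpa only [Set.piecewise_eq_indicator] using
      (hφ.mono hED).measurable_piecewise (g := 0) continuousOn_const hE
  exact (hindicator hA hAD).sub (hindicator hB hBD)

lemma integrable_indicatorDiff {X : Type*} [MeasurableSpace X] {μ : Measure X} {φ : X → ℝ}
    {D A B : Set X} (hφ : IntegrableOn φ D μ)
    (hA : MeasurableSet A) (hB : MeasurableSet B) (hAD : A ⊆ D) (hBD : B ⊆ D) :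
    Integrable (indicatorDiff A B φ) μ :=
  ((integrable_indicator_iff hA).2 (hφ.mono_set hAD)).sub
    ((integrable_indicator_iff hB).2 (hφ.mono_set hBD))

lemma integral_indicatorDiff {X : Type*} [MeasurableSpace X] {μ : Measure X} {φ : X → ℝ}
    {D A B : Set X} (hφ : IntegrableOn φ D μ)
    (hA : MeasurableSet A) (hB : MeasurableSet B) (hAD : A ⊆ D) (hBD : B ⊆ D) :
    ∫ x, indicatorDiff A B φ x ∂μ = (∫ x in A, φ x ∂μ) - ∫ x in B, φ x ∂μ := by
  rw [← integral_indicator hA, ← integral_indicator hB]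
  exact integral_sub ((integrable_indicator_iff hA).2 (hφ.mono_set hAD))
    ((integrable_indicator_iff hB).2 (hφ.mono_set hBD))

lemma integral_indicatorDiff_Iio (a : ℝ) :
    ∫ y, indicatorDiff (Set.Iio a) (Set.Iio 0) 1 y = a := by
  rcases le_total 0 a with h | h
  · have hstep : indicatorDiff (Set.Iio a) (Set.Iio 0) 1 = (Set.Ico 0 a).indicator 1 := by
      ext y
      simp only [indicatorDiff, Set.indicator_apply, Set.mem_Iio, Set.mem_Ico, Pi.one_apply]
      split_ifs <;> grind
    rw [hstep, integral_indicator_one measurableSet_Ico, Real.volume_real_Ico_of_le h, sub_zero]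
  · have hstep : indicatorDiff (Set.Iio a) (Set.Iio 0) 1 =
        fun y => -(Set.Ico a 0).indicator 1 y := by
      ext y
      simp only [indicatorDiff, Set.indicator_apply, Set.mem_Iio, Set.mem_Ico, Pi.one_apply]
      split_ifs <;> grind
    rw [hstep, integral_neg, integral_indicator_one measurableSet_Ico,
      Real.volume_real_Ico_of_le h, zero_sub, neg_neg]

lemma sign_mul_indicatorDiff_Iio {ε a y : ℝ} (hε : ε ≠ 0) (hya : y ≠ a) (hy : y ≠ 0) :
    SignType.sign ε * indicatorDiff (Set.Iio (ε * a)) (Set.Iio 0) 1 (ε * y) =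
      indicatorDiff (Set.Iio a) (Set.Iio 0) 1 y := by
  simp only [indicatorDiff, Set.indicator_apply, Set.mem_Iio, Pi.one_apply]
  rcases hε.lt_or_gt with h | h
  · simp only [sign_neg h, SignType.coe_neg_one, mul_lt_mul_left_of_neg h, mul_neg_iff, h, h.not_gt,
      false_and, true_and, false_or]
    grind
  · simp only [sign_pos h, SignType.coe_one, mul_lt_mul_iff_right₀ h, mul_neg_iff, h, h.not_gt,
      false_and, true_and, or_false, one_mul]

lemma inv_mul_integral_eq_integral_rescaled (f : ℝ → ℝ) (R ε : ℝ) :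
    ε⁻¹ * ∫ r, f r = ∫ y, SignType.sign ε * f (R + ε * y) := by
  have hscale := Measure.integral_comp_mul_left (fun r => f (R + r)) ε
  rw [integral_add_left_eq_self, smul_eq_mul] at hscale
  have hsign : (SignType.sign ε : ℝ) * |ε⁻¹| = ε⁻¹ := by
    rcases lt_trichotomy ε 0 with h | rfl | h
    · rw [sign_neg h, SignType.coe_neg_one, abs_of_neg (inv_lt_zero.2 h), neg_mul_neg, one_mul]
    · simp
    · rw [sign_pos h, SignType.coe_one, abs_of_pos (inv_pos.2 h), one_mul]
  rw [integral_const_mul, hscale, ← mul_assoc, hsign]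

lemma abs_inv_mul_integral_le {f : ℝ → ℝ} {R C M ε : ℝ} (hC : 0 ≤ C) (hε : ε ≠ 0)
    (hf : ∀ r, |f r| ≤ (Metric.closedBall R (C * |ε|)).indicator (fun _ => M) r) :
    |ε⁻¹ * ∫ r, f r| ≤ 2 * C * M := by
  have hδ : 0 ≤ C * |ε| := by positivity
  have hint : Integrable ((Metric.closedBall R (C * |ε|)).indicator fun _ => M) :=
    (integrable_indicator_iff measurableSet_closedBall).2
      (integrableOn_const measure_closedBall_lt_top.ne)
  have hle : |∫ r, f r| ≤ 2 * (C * |ε|) * M := by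
    refine (norm_integral_le_of_norm_le (f := f) hint (ae_of_all _ hf)).trans_eq ?_
    rw [integral_indicator measurableSet_closedBall, setIntegral_const,
      Real.volume_real_closedBall hδ, smul_eq_mul]
  calc |ε⁻¹ * ∫ r, f r| = |ε|⁻¹ * |∫ r, f r| := by rw [abs_mul, abs_inv]
    _ ≤ |ε|⁻¹ * (2 * (C * |ε|) * M) := by gcongr
    _ = 2 * C * M := by
      have := abs_ne_zero.2 hε
      field_simp

lemma tendsto_inv_mul_integral_of_rescaled {F : ℝ → ℝ → ℝ} {L : ℝ → ℝ} {R C M : ℝ}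
    (hF : ∀ ε, Measurable (F ε))
    (hbound : ∀ᶠ ε in 𝓝[≠] (0 : ℝ),
      ∀ r, |F ε r| ≤ (Metric.closedBall R (C * |ε|)).indicator (fun _ => M) r)
    (hlim : ∀ᵐ y, Tendsto (fun ε => SignType.sign ε * F ε (R + ε * y)) (𝓝[≠] 0) (𝓝 (L y))) :
    Tendsto (fun ε => ε⁻¹ * ∫ r, F ε r) (𝓝[≠] 0) (𝓝 (∫ y, L y)) := by
  simp only [inv_mul_integral_eq_integral_rescaled _ R]
  refine tendsto_integral_filter_of_dominated_convergence
    ((Metric.closedBall 0 C).indicator fun _ => M) (Eventually.of_forall fun ε => ?_) ?_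
    ((integrable_indicator_iff measurableSet_closedBall).2
      (integrableOn_const measure_closedBall_lt_top.ne)) hlim
  · exact (((hF ε).comp (by fun_prop : Measurable fun y : ℝ => R + ε * y)).const_mul
      _).aestronglyMeasurable
  · filter_upwards [hbound, self_mem_nhdsWithin] with ε hle (hε : ε ≠ 0)
    refine ae_of_all _ fun y => ?_
    have hmem : R + ε * y ∈ Metric.closedBall R (C * |ε|) ↔ y ∈ Metric.closedBall 0 C := by
      rw [Metric.mem_closedBall, Real.dist_eq, add_sub_cancel_left, abs_mul, mul_comm |ε|,
        mul_le_mul_iff_left₀ (abs_pos.2 hε), mem_closedBall_zero_iff, Real.norm_eq_abs]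
    have hsign : |(SignType.sign ε : ℝ)| = 1 := by
      rcases hε.lt_or_gt with h | h
      · rw [sign_neg h, SignType.coe_neg_one, abs_neg, abs_one]
      · rw [sign_pos h, SignType.coe_one, abs_one]
    rw [Real.norm_eq_abs, abs_mul, hsign, one_mul]
    refine (hle _).trans_eq ?_
    by_cases hy : y ∈ Metric.closedBall 0 C
    · rw [Set.indicator_of_mem (hmem.2 hy), Set.indicator_of_mem hy]
    · rw [Set.indicator_of_notMem (mt hmem.1 hy), Set.indicator_of_notMem hy]

/-- The density of `f` in polar coordinates along the ray of angle `θ`, extended by zero to negative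
radii. -/
def rayDensity (f : ℂ → ℝ) (θ r : ℝ) : ℝ :=
  (Set.Ioi 0).indicator (fun r => r * f (circleMap 0 r θ)) r

lemma measurable_rayDensity {f : ℂ → ℝ} (hf : Measurable f) (θ : ℝ) :
    Measurable (rayDensity f θ) := by
  have hcircle : Measurable fun r : ℝ => circleMap 0 r θ := by
    unfold circleMap
    fun_prop
  exact (measurable_id.mul (hf.comp hcircle)).indicator measurableSet_Ioi

lemma integrableOn_integral_rayDensity {f : ℂ → ℝ} (hf : Integrable f) :
    IntegrableOn (fun θ => ∫ r, rayDensity f θ r) (Set.Ioo (-π) π) := by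
  simp only [rayDensity, integral_indicator measurableSet_Ioi]
  exact (integrable_polar_prod hf).integral_prod_right

lemma integral_eq_integral_rayDensity {f : ℂ → ℝ} (hf : Integrable f) :
    ∫ z, f z = ∫ θ in Set.Ioo (-π) π, ∫ r, rayDensity f θ r := by
  simp only [rayDensity, integral_indicator measurableSet_Ioi]
  rw [integral_eq_integral_polar, polarCoord_target, Measure.volume_eq_prod,
    ← Measure.prod_restrict, integral_prod_symm _ (integrable_polar_prod hf)]
  simp only [smul_eq_mul]

lemma tendsto_inv_mul_integral_of_rays {F : ℝ → ℂ → ℝ} {L : ℝ → ℝ} {R C M : ℝ} (hC : 0 ≤ C)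
    (hF : ∀ᶠ ε in 𝓝[≠] (0 : ℝ), Integrable (F ε))
    (hbound : ∀ᶠ ε in 𝓝[≠] (0 : ℝ), ∀ θ r,
      |rayDensity (F ε) θ r| ≤ (Metric.closedBall R (C * |ε|)).indicator (fun _ => M) r)
    (hlim : ∀ θ, Tendsto (fun ε => ε⁻¹ * ∫ r, rayDensity (F ε) θ r) (𝓝[≠] 0) (𝓝 (L θ))) :
    Tendsto (fun ε => ε⁻¹ * ∫ z, F ε z) (𝓝[≠] 0) (𝓝 (∫ θ in Set.Ioo (-π) π, L θ)) := by
  have hpolar : (fun ε => ∫ θ in Set.Ioo (-π) π, ε⁻¹ * ∫ r, rayDensity (F ε) θ r) =ᶠ[𝓝[≠] 0]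
      fun ε => ε⁻¹ * ∫ z, F ε z := by
    filter_upwards [hF] with ε hε
    rw [integral_const_mul, integral_eq_integral_rayDensity hε]
  refine Tendsto.congr' hpolar ?_
  refine tendsto_integral_filter_of_dominated_convergence (fun _ => 2 * C * M) ?_ ?_
    (integrableOn_const measure_Ioo_lt_top.ne) (ae_of_all _ hlim)
  · filter_upwards [hF] with ε hε
    exact ((integrableOn_integral_rayDensity hε).const_mul _).aestronglyMeasurable
  · filter_upwards [hbound, self_mem_nhdsWithin] with ε hε (hε₀ : ε ≠ 0)
    exact ae_of_all _ fun θ => abs_inv_mul_integral_le hC hε₀ (hε θ)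

lemma abs_rayDensity_indicatorDiff_le {φ : ℂ → ℝ} {A : Set ℂ} {R R' δ M : ℝ}
    (hM : ∀ z ∈ Metric.closedBall (0 : ℂ) R', |φ z| ≤ M) (hδ : 0 ≤ δ) (hR' : R + δ ≤ R')
    (hR₀ : 0 ≤ R) (hthin : ∀ z, ¬(z ∈ A ↔ z ∈ Metric.ball (0 : ℂ) R) → |‖z‖ - R| ≤ δ) (θ r : ℝ) :
    |rayDensity (indicatorDiff A (Metric.ball 0 R) φ) θ r| ≤
      (Metric.closedBall R δ).indicator (fun _ => R' * M) r := by
  have hR'_nonneg : 0 ≤ R' := by linarith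
  have hM_nonneg : 0 ≤ M := (abs_nonneg _).trans (hM 0 (Metric.mem_closedBall_self hR'_nonneg))
  have hbound_nonneg : 0 ≤ (Metric.closedBall R δ).indicator (fun _ => R' * M) r :=
    Set.indicator_nonneg (fun _ _ => by positivity) r
  by_cases hr : 0 < r
  swap
  · rwa [rayDensity, Set.indicator_of_notMem (Set.notMem_Ioi.2 (not_lt.1 hr)), abs_zero]
  rw [rayDensity, Set.indicator_of_mem (Set.mem_Ioi.2 hr), abs_mul, abs_of_pos hr]
  by_cases hmem : circleMap 0 r θ ∈ A ↔ circleMap 0 r θ ∈ Metric.ball (0 : ℂ) R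
  · rwa [indicatorDiff_of_mem_iff φ hmem, abs_zero, mul_zero]
  have hrR : |r - R| ≤ δ := by
    simpa only [norm_circleMap_zero, abs_of_pos hr] using hthin _ hmem
  have hrR' : r ≤ R' := by linarith [(abs_le.1 hrR).2]
  rw [Set.indicator_of_mem (Metric.mem_closedBall.2 hrR)]
  refine mul_le_mul hrR' ((abs_indicatorDiff_le _ _ _ _).trans (hM _ ?_)) (abs_nonneg _) hR'_nonneg
  rwa [mem_closedBall_zero_iff, norm_circleMap_zero, abs_of_pos hr]

lemma tendsto_rayDensity_rescaled {φ : ℂ → ℝ} {S : ℝ → Set ℂ} {R θ a y : ℝ} (hR : 0 < R)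
    (hφ : ContinuousAt φ (circleMap 0 R θ)) (hya : y ≠ a) (hy : y ≠ 0)
    (hray : ∀ᶠ ε in 𝓝[≠] (0 : ℝ), (circleMap 0 (R + ε * y) θ ∈ S ε ↔ ε * y < ε * a)) :
    Tendsto (fun ε => SignType.sign ε *
        rayDensity (indicatorDiff (S ε) (Metric.ball 0 R) φ) θ (R + ε * y)) (𝓝[≠] 0)
      (𝓝 (R * φ (circleMap 0 R θ) * indicatorDiff (Set.Iio a) (Set.Iio 0) 1 y)) := by
  have hcont : ContinuousAt (fun ε : ℝ => R + ε * y) 0 := by fun_prop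
  have hradius : Tendsto (fun ε : ℝ => R + ε * y) (𝓝[≠] 0) (𝓝 R) := by
    simpa only [zero_mul, add_zero] using hcont.tendsto.mono_left nhdsWithin_le_nhds
  have hcircle : ContinuousAt (fun r : ℝ => circleMap 0 r θ) R := by
    simp only [circleMap_zero]
    fun_prop
  have hlim := (hradius.mul ((hφ.tendsto.comp hcircle.tendsto).comp hradius)).mul_const
    (indicatorDiff (Set.Iio a) (Set.Iio 0) 1 y)
  refine hlim.congr' ?_
  filter_upwards [hradius.eventually (lt_mem_nhds hR), hray, self_mem_nhdsWithin]
    with ε hpos hmem (hε : ε ≠ 0)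
  have hball : circleMap 0 (R + ε * y) θ ∈ Metric.ball (0 : ℂ) R ↔ ε * y ∈ Set.Iio 0 := by
    rw [mem_ball_zero_iff, norm_circleMap_zero, abs_of_pos hpos, add_lt_iff_neg_left, Set.mem_Iio]
  rw [rayDensity, Set.indicator_of_mem (Set.mem_Ioi.2 hpos),
    indicatorDiff_eq_mul (A' := Set.Iio (ε * a)) φ hmem hball,
    ← sign_mul_indicatorDiff_Iio hε hya hy]
  simp only [Function.comp_apply]
  ring

lemma exists_rayDensity_bound_of_thin {φ : ℂ → ℝ} {S : ℝ → Set ℂ} {R ρ C : ℝ} (hR : 0 ≤ R)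
    (hRρ : R < ρ) (hC : 0 ≤ C) (hφ : ContinuousOn φ (Metric.ball 0 ρ))
    (hthin : ∀ᶠ ε in 𝓝 (0 : ℝ), ∀ z, ¬(z ∈ S ε ↔ z ∈ Metric.ball (0 : ℂ) R) →
      |‖z‖ - R| ≤ C * |ε|) :
    ∃ R' M, R < R' ∧ R' < ρ ∧ ∀ᶠ ε in 𝓝 (0 : ℝ), S ε ⊆ Metric.closedBall 0 R' ∧
      ∀ θ r, |rayDensity (indicatorDiff (S ε) (Metric.ball 0 R) φ) θ r| ≤
        (Metric.closedBall R (C * |ε|)).indicator (fun _ => M) r := by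
  obtain ⟨R', hRR', hR'ρ⟩ := exists_between hRρ
  obtain ⟨M, hM⟩ := (isCompact_closedBall (0 : ℂ) R').exists_bound_of_continuousOn
    (hφ.mono (Metric.closedBall_subset_ball hR'ρ))
  refine ⟨R', R' * M, hRR', hR'ρ, ?_⟩
  have hsmall : ∀ᶠ ε in 𝓝 (0 : ℝ), R + C * |ε| ≤ R' := by
    have hcont : Continuous fun ε : ℝ => R + C * |ε| := by fun_prop
    refine (hcont.tendsto' 0 R ?_).eventually (ge_mem_nhds hRR')
    rw [abs_zero, mul_zero, add_zero]
  filter_upwards [hthin, hsmall] with ε hε hεR'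
  refine ⟨fun z hz => ?_, abs_rayDensity_indicatorDiff_le hM (by positivity) hεR' hR hε⟩
  rw [mem_closedBall_zero_iff]
  by_cases hball : z ∈ Metric.ball (0 : ℂ) R
  · exact (mem_ball_zero_iff.1 hball).le.trans hRR'.le
  · linarith [(abs_le.1 (hε z fun h => hball (h.1 hz))).2]

lemma hasDerivAt_setIntegral_of_moving_boundary {φ : ℂ → ℝ} {S : ℝ → Set ℂ} {a : ℝ → ℝ}
    {R ρ C : ℝ} (hR : 0 < R) (hRρ : R < ρ) (hC : 0 ≤ C)
    (hφ : ContinuousOn φ (Metric.ball 0 ρ)) (hS_meas : ∀ ε, MeasurableSet (S ε))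
    (hS_ball : ∀ ε, S ε ⊆ Metric.ball 0 ρ) (hS_zero : S 0 = Metric.ball 0 R)
    (hthin : ∀ᶠ ε in 𝓝 (0 : ℝ), ∀ z, ¬(z ∈ S ε ↔ z ∈ Metric.ball (0 : ℂ) R) →
      |‖z‖ - R| ≤ C * |ε|)
    (hray : ∀ θ y, y ≠ a θ → ∀ᶠ ε in 𝓝[≠] (0 : ℝ),
      (circleMap 0 (R + ε * y) θ ∈ S ε ↔ ε * y < ε * a θ)) :
    HasDerivAt (fun ε => ∫ z in S ε, φ z)
      (∫ θ in Set.Ioo (-π) π, R * φ (circleMap 0 R θ) * a θ) 0 := by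
  obtain ⟨R', M, hRR', hR'ρ, hbound⟩ := exists_rayDensity_bound_of_thin hR.le hRρ hC hφ hthin
  replace hbound := hbound.filter_mono (nhdsWithin_le_nhds (s := {0}ᶜ))
  have hφ_int : IntegrableOn φ (Metric.closedBall 0 R') :=
    (hφ.mono (Metric.closedBall_subset_ball hR'ρ)).integrableOn_compact (isCompact_closedBall _ _)
  have hball_sub : Metric.ball (0 : ℂ) R ⊆ Metric.closedBall 0 R' :=
    Metric.ball_subset_closedBall.trans (Metric.closedBall_subset_closedBall hRR'.le)
  set F : ℝ → ℂ → ℝ := fun ε => indicatorDiff (S ε) (Metric.ball 0 R) φ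
  have hF_meas : ∀ ε, Measurable (F ε) := fun ε => measurable_indicatorDiff hφ (hS_meas ε)
    measurableSet_ball (hS_ball ε) (Metric.ball_subset_ball hRρ.le)
  have hF_ray : ∀ θ, Tendsto (fun ε => ε⁻¹ * ∫ r, rayDensity (F ε) θ r) (𝓝[≠] 0)
      (𝓝 (R * φ (circleMap 0 R θ) * a θ)) := fun θ => by
    rw [← integral_indicatorDiff_Iio (a θ), ← integral_const_mul]
    refine tendsto_inv_mul_integral_of_rescaled (fun ε => measurable_rayDensity (hF_meas ε) θ)
      (hbound.mono fun ε hε => hε.2 θ) ?_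
    filter_upwards [Measure.ae_ne volume (a θ), Measure.ae_ne volume 0] with y hya hy
    refine tendsto_rayDensity_rescaled hR (hφ.continuousAt (Metric.isOpen_ball.mem_nhds ?_)) hya hy
      (hray θ y hya)
    rwa [mem_ball_zero_iff, norm_circleMap_zero, abs_of_pos hR]
  rw [hasDerivAt_iff_tendsto_slope_zero]
  refine (tendsto_inv_mul_integral_of_rays hC (hbound.mono fun ε hε =>
    integrable_indicatorDiff hφ_int (hS_meas ε) measurableSet_ball hε.1 hball_sub)
    (hbound.mono fun ε hε => hε.2) hF_ray).congr' ?_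
  filter_upwards [hbound] with ε hε
  rw [integral_indicatorDiff hφ_int (hS_meas ε) measurableSet_ball hε.1 hball_sub, zero_add,
    hS_zero, smul_eq_mul]

end MovingBoundary

section HyperbolicMeasure

/-- The density of the hyperbolic measure `hyp` with respect to the Lebesgue measure. -/
def density (z : ℂ) : ℝ := ((1 - ‖z‖ ^ 2) ^ 2)⁻¹

lemma measurable_density : Measurable density := by
  unfold density
  fun_prop

lemma density_nonneg (z : ℂ) : 0 ≤ density z := inv_nonneg.2 (sq_nonneg _)

lemma continuousOn_density : ContinuousOn density disk :=
  ContinuousOn.inv₀ (by fun_prop) fun _ hz => (pow_pos (one_sub_sq_norm_pos hz) 2).ne'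

lemma density_mul_weight_add_two (β : ℝ) {z : ℂ} (hz : z ∈ disk) :
    density z * weight (β + 2) z = weight β z := by
  have hpos := one_sub_sq_norm_pos hz
  rw [density, weight_add β 2 hz, weight, weight, rpow_two]
  field_simp

lemma hyp_absolutelyContinuous : hyp ≪ volume :=
  (withDensity_absolutelyContinuous _ _).trans Measure.absolutelyContinuous_restrict

lemma setIntegral_hyp {E : Set ℂ} (hE : MeasurableSet E) (hED : E ⊆ disk) (ψ : ℂ → ℝ) :
    ∫ z in E, ψ z ∂hyp = ∫ z in E, density z * ψ z := by
  change ∫ z in E, ψ z ∂(volume.restrict disk).withDensity (fun z => ENNReal.ofReal (density z)) = _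
  rw [setIntegral_withDensity_eq_setIntegral_toReal_smul measurable_density.ennreal_ofReal
    (ae_of_all _ fun _ => ENNReal.ofReal_lt_top) _ hE, Measure.restrict_restrict hE,
    Set.inter_eq_left.2 hED]
  simp only [ENNReal.toReal_ofReal (density_nonneg _), smul_eq_mul]

lemma hyp_eq_ofReal {R : ℝ} (hR : R < 1) {E : Set ℂ} (hE : MeasurableSet E)
    (hER : E ⊆ Metric.closedBall 0 R) : hyp E = ENNReal.ofReal (∫ z in E, density z) := by
  have hint : IntegrableOn density (Metric.closedBall 0 R) :=
    (continuousOn_density.mono (closedBall_subset_disk hR)).integrableOn_compact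
      (isCompact_closedBall _ _)
  rw [ofReal_integral_eq_lintegral_ofReal (hint.mono_set hER) (ae_of_all _ density_nonneg)]
  change (volume.restrict disk).withDensity (fun z => ENNReal.ofReal (density z)) E = _
  rw [withDensity_apply _ hE, Measure.restrict_restrict hE,
    Set.inter_eq_left.2 (hER.trans (closedBall_subset_disk hR))]

lemma hyp_ne_top {R : ℝ} (hR : R < 1) {E : Set ℂ} (hER : E ⊆ Metric.closedBall 0 R) :
    hyp E ≠ ⊤ := by
  refine measure_ne_top_of_subset hER ?_
  rw [hyp_eq_ofReal hR measurableSet_closedBall le_rfl]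
  exact ENNReal.ofReal_ne_top

/-- The hyperbolic area of the disk `{‖z‖ < R}`, for `0 ≤ R < 1`. -/
def hypArea (R : ℝ) : ℝ := π * R ^ 2 / (1 - R ^ 2)

lemma hypArea_lt_hypArea {R R' : ℝ} (hR : 0 ≤ R) (hRR' : R < R') (hR' : R' < 1) :
    hypArea R < hypArea R' := by
  have := one_sub_sq_pos (hR.trans hRR'.le) hR'
  have := pi_pos
  unfold hypArea
  gcongr

lemma hypArea_nonneg {R : ℝ} (hR0 : 0 ≤ R) (hR1 : R < 1) : 0 ≤ hypArea R :=
  div_nonneg (by positivity) (one_sub_sq_pos hR0 hR1).le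

lemma hyp_ball {R : ℝ} (hR0 : 0 ≤ R) (hR1 : R < 1) :
    hyp (Metric.ball 0 R) = ENNReal.ofReal (hypArea R) := by
  have hint : IntegrableOn density (Metric.ball 0 R) :=
    ((continuousOn_density.mono (closedBall_subset_disk hR1)).integrableOn_compact
      (isCompact_closedBall _ _)).mono_set Metric.ball_subset_closedBall
  have hpos : ∀ r ∈ Set.Icc 0 R, 0 < 1 - r ^ 2 := fun r hr =>
    one_sub_sq_pos hr.1 (hr.2.trans_lt hR1)
  have hderiv : ∀ r ∈ Set.Ioo 0 R,
      HasDerivAt (fun r : ℝ => (1 - r ^ 2)⁻¹ / 2) (r * ((1 - r ^ 2) ^ 2)⁻¹) r := fun r hr => by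
    have hr' := (hpos r (Set.Ioo_subset_Icc_self hr)).ne'
    convert! ((hasDerivAt_one_sub_sq r).inv hr').div_const 2 using 1
    field_simp
  have hcont : ContinuousOn (fun r : ℝ => (1 - r ^ 2)⁻¹ / 2) (Set.Icc 0 R) :=
    (ContinuousOn.inv₀ (by fun_prop) fun r hr => (hpos r hr).ne').div_const 2
  rw [hyp_eq_ofReal hR1 measurableSet_ball Metric.ball_subset_closedBall]
  congr 1
  refine (setIntegral_ball_radial (w := fun r => ((1 - r ^ 2) ^ 2)⁻¹) hint).trans ?_
  rw [(integrableOn_and_integral_Ioo_of_hasDerivAt hR0 hcont hderiv fun r hr => by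
    have := hr.1
    positivity).2, hypArea]
  have := one_sub_sq_pos hR0 hR1
  field_simp
  ring

end HyperbolicMeasure

section SuperlevelSets

variable {α : ℝ} {f g : ℂ → ℂ}

lemma continuousOn_u (hf : ContinuousOn f disk) : ContinuousOn (u α f) disk :=
  (hf.norm.pow 2).mul (continuousOn_weight (α + 2))

lemma isOpen_superlevel (hf : ContinuousOn f disk) (t : ℝ) : IsOpen (superlevel α f t) :=
  (continuousOn_u hf).isOpen_inter_preimage isOpen_disk isOpen_Ioi

lemma superlevel_anti (f : ℂ → ℂ) {t t' : ℝ} (h : t ≤ t') :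
    superlevel α f t' ⊆ superlevel α f t := fun _ hz => ⟨hz.1, h.trans_lt hz.2⟩

lemma superlevel_subset_disk (f : ℂ → ℂ) (t : ℝ) : superlevel α f t ⊆ disk := fun _ hz => hz.1

lemma measurableSet_level (hf : ContinuousOn f disk) (t : ℝ) :
    MeasurableSet {z | z ∈ disk ∧ u α f z = t} := by
  have heq : {z | z ∈ disk ∧ u α f z = t} =
      (disk \ superlevel α f t) \ (disk ∩ u α f ⁻¹' Set.Iio t) := by
    ext z
    simp only [superlevel, Set.mem_ofPred_eq, Set.mem_sdiff, Set.mem_inter_iff, Set.mem_preimage,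
      Set.mem_Iio]
    grind
  rw [heq]
  exact (measurableSet_disk.diff (isOpen_superlevel hf t).measurableSet).diff
    ((continuousOn_u hf).isOpen_inter_preimage isOpen_disk isOpen_Iio).measurableSet

lemma measure_eq_zero_of_ae_notMem_rays {N : Set ℂ} (hN : MeasurableSet N)
    (h : ∀ θ, ∀ᵐ r ∂(volume.restrict (Set.Ioi (0 : ℝ))), circleMap 0 r θ ∉ N) :
    volume N = 0 := by
  have hpolar := Complex.lintegral_comp_polarCoord_symm (N.indicator 1)
  have hcircle : Measurable fun p : ℝ × ℝ => circleMap 0 p.1 p.2 := by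
    unfold circleMap
    fun_prop
  have hmeas : Measurable fun p : ℝ × ℝ =>
      ENNReal.ofReal p.1 • (N.indicator 1 (circleMap 0 p.1 p.2) : ENNReal) :=
    measurable_fst.ennreal_ofReal.smul ((measurable_one.indicator hN).comp hcircle)
  rw [lintegral_indicator_one hN] at hpolar
  simp only [polarCoord_symm_eq_circleMap] at hpolar
  rw [← hpolar, polarCoord_target, Measure.volume_eq_prod, ← Measure.prod_restrict,
    lintegral_prod_symm _ hmeas.aemeasurable]
  refine lintegral_eq_zero_of_ae_eq_zero (ae_of_all _ fun θ => ?_)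
  refine lintegral_eq_zero_of_ae_eq_zero ?_
  filter_upwards [h θ] with r hr
  simp only [Set.indicator_of_notMem hr, smul_zero, Pi.zero_apply]

lemma circleMap_mem_disk_iff {r : ℝ} (hr : 0 ≤ r) (θ : ℝ) : circleMap 0 r θ ∈ disk ↔ r < 1 := by
  rw [mem_disk_iff, norm_circleMap_zero, abs_of_nonneg hr]

lemma analyticOnNhd_comp_ray (hf : DifferentiableOn ℂ f disk) (θ : ℝ) :
    AnalyticOnNhd ℝ (fun r : ℝ => f (circleMap 0 r θ)) (Set.Ioo 0 1) := fun r hr => by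
  have hmem : circleMap 0 r θ ∈ disk := (circleMap_mem_disk_iff hr.1.le θ).2 hr.2
  have hray : AnalyticAt ℝ (fun r : ℝ => circleMap 0 r θ) r := by
    simp only [circleMap_zero]
    exact (Complex.ofRealCLM.analyticAt r).mul analyticAt_const
  have hfz : AnalyticAt ℝ f (circleMap 0 r θ) :=
    (hf.analyticAt (isOpen_disk.mem_nhds hmem)).restrictScalars
  exact AnalyticAt.comp (f := fun r : ℝ => circleMap 0 r θ) hfz hray

lemma analyticOnNhd_u_ray (hf : DifferentiableOn ℂ f disk) (θ : ℝ) :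
    AnalyticOnNhd ℝ (fun r : ℝ => u α f (circleMap 0 r θ)) (Set.Ioo 0 1) := fun r hr => by
  have hfr := analyticOnNhd_comp_ray hf θ r hr
  have hre : AnalyticAt ℝ (fun r : ℝ => (f (circleMap 0 r θ)).re) r :=
    (Complex.reCLM.analyticAt _).comp hfr
  have him : AnalyticAt ℝ (fun r : ℝ => (f (circleMap 0 r θ)).im) r :=
    (Complex.imCLM.analyticAt _).comp hfr
  have hweight : AnalyticAt ℝ (fun r : ℝ => (1 - r ^ 2) ^ (α + 2)) r :=
    ContDiffAt.analyticAt
      (ContDiffAt.rpow_const_of_ne (by fun_prop) (one_sub_sq_pos hr.1.le hr.2).ne')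
  convert! ((hre.mul hre).add (him.mul him)).mul hweight using 2
  rw [u, norm_circleMap_zero, sq_abs, ← Complex.normSq_eq_norm_sq, Complex.normSq_apply,
    Pi.mul_apply, Pi.add_apply, Pi.mul_apply, Pi.mul_apply]

/- By the identity theorem `u = t` either holds only at isolated points of a ray, or all along the
ray; the latter would contradict the confinement of `{u > t₁}`. -/
lemma volume_level_eq_zero (hf : DifferentiableOn ℂ f disk) {R₁ t₁ t : ℝ} (hR₁ : R₁ < 1)
    (hsub : superlevel α f t₁ ⊆ Metric.closedBall 0 R₁) (ht : t₁ < t) :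
    volume {z | z ∈ disk ∧ u α f z = t} = 0 := by
  refine measure_eq_zero_of_ae_notMem_rays (measurableSet_level hf.continuousOn t) fun θ => ?_
  have hray : ∀ᵐ r ∂(volume.restrict (Set.Ioo (0 : ℝ) 1)), u α f (circleMap 0 r θ) - t ≠ 0 := by
    have hanalytic : AnalyticOnNhd ℝ (fun r : ℝ => u α f (circleMap 0 r θ) - t) (Set.Ioo 0 1) :=
      (analyticOnNhd_u_ray hf θ).sub analyticOnNhd_const
    rcases hanalytic.eqOn_zero_or_eventually_ne_zero_of_preconnected isPreconnected_Ioo with h | h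
    · obtain ⟨r, hr, hr1⟩ := exists_between (max_lt one_pos hR₁)
      obtain ⟨hr0, hrR₁⟩ := max_lt_iff.1 hr
      have hu : u α f (circleMap 0 r θ) = t := sub_eq_zero.1 (h ⟨hr0, hr1⟩)
      have hmem : circleMap 0 r θ ∈ superlevel α f t₁ :=
        ⟨(circleMap_mem_disk_iff hr0.le θ).2 hr1, by rwa [hu]⟩
      have hle := hsub hmem
      rw [mem_closedBall_zero_iff, norm_circleMap_zero, abs_of_pos hr0] at hle
      exact absurd hle hrR₁.not_ge
    · exact ae_restrict_le_codiscreteWithin measurableSet_Ioo h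
  rw [ae_restrict_iff' measurableSet_Ioo] at hray
  rw [ae_restrict_iff' measurableSet_Ioi]
  filter_upwards [hray] with r hr hr0 hmem
  exact hr ⟨hr0, (circleMap_mem_disk_iff (le_of_lt hr0) θ).1 hmem.1⟩ (sub_eq_zero.2 hmem.2)

lemma differentiableOn_pert (hg : DifferentiableOn ℂ g disk) (ε : ℝ) :
    DifferentiableOn ℂ (pert α g ε) disk :=
  (differentiableOn_const _).add (hg.const_mul _)

lemma u_pert (g : ℂ → ℂ) (ε : ℝ) (z : ℂ) :
    u α (pert α g ε) z = c₀ α ^ 2 * weight (α + 2) z +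
      2 * c₀ α * ε * ((g z).re * weight (α + 2) z) + ε ^ 2 * (‖g z‖ ^ 2 * weight (α + 2) z) := by
  rw [u, sq_norm_pert, weight]
  ring

lemma u_pert_zero (g : ℂ → ℂ) (z : ℂ) : u α (pert α g 0) z = c₀ α ^ 2 * weight (α + 2) z := by
  simp only [u_pert, mul_zero, zero_mul, add_zero, ne_eq, OfNat.ofNat_ne_zero, not_false_eq_true,
    zero_pow]

lemma continuous_u_pert (g : ℂ → ℂ) (z : ℂ) : Continuous fun ε => u α (pert α g ε) z := by
  simp only [u_pert]
  fun_prop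

/-- The value of `u` for the unperturbed function `f₀` on the circle of radius `R`. -/
def baseLevel (α R : ℝ) : ℝ := c₀ α ^ 2 * (1 - R ^ 2) ^ (α + 2)

lemma superlevel_pert_zero (hα : -1 < α) (g : ℂ → ℂ) {R : ℝ} (hR0 : 0 ≤ R) (hR1 : R < 1) :
    superlevel α (pert α g 0) (baseLevel α R) = Metric.ball 0 R := by
  ext z
  have hR := one_sub_sq_pos hR0 hR1
  have hlevel : z ∈ disk → (baseLevel α R < u α (pert α g 0) z ↔ ‖z‖ < R) := fun hz => by
    rw [baseLevel, u_pert_zero, mul_lt_mul_iff_right₀ (pow_pos (c₀_pos hα) 2), weight,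
      rpow_lt_rpow_iff hR.le (one_sub_sq_norm_pos hz).le (by linarith), sub_lt_sub_iff_left,
      sq_lt_sq₀ (norm_nonneg z) hR0]
  rw [mem_ball_zero_iff]
  exact ⟨fun h => (hlevel h.1).1 h.2,
    fun h => have hz := mem_disk_iff.2 (h.trans hR1); ⟨hz, (hlevel hz).2 h⟩⟩

end SuperlevelSets

section Confinement

variable {α : ℝ} {g : ℂ → ℂ}

lemma ball_subset_superlevel_pert (hα : -1 < α) {R M ε t : ℝ} (hR : R < 1)
    (hM : ∀ z ∈ Metric.ball 0 R, ‖g z‖ ≤ M) (hε : |ε| * M ≤ c₀ α / 2)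
    (ht : t < (c₀ α / 2) ^ 2 * (1 - R ^ 2) ^ (α + 2)) :
    Metric.ball 0 R ⊆ superlevel α (pert α g ε) t := fun z hz => by
  have hzR := mem_ball_zero_iff.1 hz
  have hc := c₀_pos hα
  have hRw := one_sub_sq_pos ((norm_nonneg z).trans hzR.le) hR
  refine ⟨mem_disk_iff.2 (hzR.trans hR), ht.trans_le ?_⟩
  have hlower : c₀ α / 2 ≤ ‖pert α g ε z‖ := by
    have htriangle : ‖f₀ α z‖ - ‖ε * g z‖ ≤ ‖pert α g ε z‖ := norm_sub_le_norm_add _ _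
    have hf₀ : ‖f₀ α z‖ = c₀ α := (Complex.norm_real _).trans (Real.norm_of_nonneg hc.le)
    rw [hf₀, norm_mul, Complex.norm_real, Real.norm_eq_abs] at htriangle
    have hg : |ε| * ‖g z‖ ≤ |ε| * M := by gcongr; exact hM z hz
    linarith
  have hα2 : 0 ≤ α + 2 := by linarith
  unfold u
  gcongr

lemma u_pert_le (ε : ℝ) {z : ℂ} (hz : z ∈ disk) :
    u α (pert α g ε) z ≤
      2 * (c₀ α ^ 2 * weight (α + 2) z) + 2 * ε ^ 2 * (‖g z‖ ^ 2 * weight (α + 2) z) := by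
  have hre : (g z).re ^ 2 ≤ ‖g z‖ ^ 2 := by
    rw [← sq_abs]
    gcongr
    exact Complex.abs_re_le_norm _
  have hsq : ‖pert α g ε z‖ ^ 2 ≤ 2 * c₀ α ^ 2 + 2 * ε ^ 2 * ‖g z‖ ^ 2 := by
    rw [sq_norm_pert]
    nlinarith [sq_nonneg (c₀ α - ε * (g z).re), mul_le_mul_of_nonneg_left hre (sq_nonneg ε)]
  calc u α (pert α g ε) z ≤ (2 * c₀ α ^ 2 + 2 * ε ^ 2 * ‖g z‖ ^ 2) * weight (α + 2) z :=
        mul_le_mul_of_nonneg_right hsq (weight_pos _ hz).le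
    _ = _ := by ring

lemma exists_norm_le_of_le_weight {β τ : ℝ} (hβ : 0 < β) (hτ : 0 < τ) :
    ∃ ρ < 1, ∀ z ∈ disk, τ ≤ weight β z → ‖z‖ ≤ ρ := by
  have hpos : 0 < τ ^ β⁻¹ := rpow_pos_of_pos hτ _
  refine ⟨√(1 - τ ^ β⁻¹), (sqrt_lt' one_pos).2 (by linarith), fun z hz hle => ?_⟩
  have hroot : τ ^ β⁻¹ ≤ 1 - ‖z‖ ^ 2 :=
    (rpow_inv_le_iff_of_pos hτ.le (one_sub_sq_norm_pos hz).le hβ).2 hle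
  exact le_sqrt_of_sq_le (by linarith)

lemma superlevel_pert_subset_closedBall (hα : -1 < α) {C ε t ρ : ℝ}
    (hC : ∀ z ∈ disk, ‖g z‖ ^ 2 * weight (α + 2) z ≤ C) (hε : 2 * ε ^ 2 * C ≤ t / 2)
    (hρ : ∀ z ∈ disk, t / (4 * c₀ α ^ 2) ≤ weight (α + 2) z → ‖z‖ ≤ ρ) :
    superlevel α (pert α g ε) t ⊆ Metric.closedBall 0 ρ := fun z ⟨hz, hlt⟩ => by
  have := c₀_pos hα
  refine mem_closedBall_zero_iff.2 (hρ z hz ?_)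
  rw [div_le_iff₀ (by positivity)]
  have hgC : 2 * ε ^ 2 * (‖g z‖ ^ 2 * weight (α + 2) z) ≤ 2 * ε ^ 2 * C := by
    gcongr
    exact hC z hz
  linarith [u_pert_le (α := α) (g := g) ε hz]

/-- For `|ε| < ε₀` the set `{u > t₁}` of the perturbation `f₀ + ε g` stays in the disk of radius
`R₁ < 1` and has hyperbolic area larger than that of the disk of radius `R`. Hence only levels above
`t₁` and points of a fixed compact disk matter for the decreasing rearrangement at
`s = hypArea R`. -/
structure Confined (α R : ℝ) (g : ℂ → ℂ) (ε₀ R₁ t₁ : ℝ) : Prop where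
  weight_exponent : -1 < α
  differentiableOn : DifferentiableOn ℂ g disk
  radius_pos : 0 < R
  radius_lt : R < R₁
  outer_lt_one : R₁ < 1
  range_pos : 0 < ε₀
  level_pos : 0 < t₁
  level_lt : t₁ < baseLevel α R
  subset_closedBall : ∀ ε, |ε| < ε₀ → superlevel α (pert α g ε) t₁ ⊆ Metric.closedBall 0 R₁
  hypArea_lt : ∀ ε, |ε| < ε₀ → ENNReal.ofReal (hypArea R) < hyp (superlevel α (pert α g ε) t₁)

lemma exists_confined (hα : -1 < α) (hg : g ∈ space α) {R : ℝ} (hR0 : 0 < R) (hR1 : R < 1) :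
    ∃ ε₀ R₁ t₁, Confined α R g ε₀ R₁ t₁ := by
  obtain ⟨C, hC⟩ := exists_growth_bound hg
  obtain ⟨R₂, hRR₂, hR₂⟩ := exists_between hR1
  obtain ⟨M, hM⟩ := (isCompact_closedBall (0 : ℂ) R₂).exists_bound_of_continuousOn
    (hg.1.continuousOn.mono (closedBall_subset_disk hR₂))
  have hc := c₀_pos hα
  have hR₂w := one_sub_sq_pos (hR0.trans hRR₂).le hR₂
  set b := (c₀ α / 2) ^ 2 * (1 - R₂ ^ 2) ^ (α + 2) with hb
  have hb0 : 0 < b := by positivity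
  obtain ⟨t₁, ht₁0, ht₁b⟩ := exists_between hb0
  obtain ⟨ρ, hρ1, hρ⟩ := exists_norm_le_of_le_weight (β := α + 2) (τ := t₁ / (4 * c₀ α ^ 2))
    (by linarith) (by positivity)
  have hM_ev : ∀ᶠ ε in 𝓝 (0 : ℝ), |ε| * M < c₀ α / 2 :=
    ContinuousAt.eventually_lt (by fun_prop) (by fun_prop) (by simpa using hc)
  have hC_ev : ∀ᶠ ε in 𝓝 (0 : ℝ), 2 * ε ^ 2 * C < t₁ / 2 :=
    ContinuousAt.eventually_lt (by fun_prop) (by fun_prop) (by simpa using ht₁0)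
  obtain ⟨ε₀, hε₀, hball⟩ := Metric.eventually_nhds_iff.1 (hM_ev.and hC_ev)
  have hsmall : ∀ ε, |ε| < ε₀ → |ε| * M < c₀ α / 2 ∧ 2 * ε ^ 2 * C < t₁ / 2 := fun ε hε =>
    hball (by rwa [Real.dist_eq, sub_zero])
  refine ⟨ε₀, max R₂ ρ, t₁, hα, hg.1, hR0, lt_max_of_lt_left hRR₂, max_lt hR₂ hρ1, hε₀, ht₁0, ?_,
    fun ε hε => ?_, fun ε hε => ?_⟩
  · refine ht₁b.trans_le ?_
    have : 0 ≤ α + 2 := by linarith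
    rw [hb, baseLevel]
    gcongr
    exact half_le_self hc.le
  · exact (superlevel_pert_subset_closedBall hα hC (hsmall ε hε).2.le hρ).trans
      (Metric.closedBall_subset_closedBall (le_max_right _ _))
  · have hlt : ENNReal.ofReal (hypArea R) < hyp (Metric.ball 0 R₂) := by
      rw [hyp_ball (hR0.trans hRR₂).le hR₂, ENNReal.ofReal_lt_ofReal_iff_of_nonneg
        (hypArea_nonneg hR0.le hR1)]
      exact hypArea_lt_hypArea hR0.le hRR₂ hR₂
    exact hlt.trans_le (measure_mono (ball_subset_superlevel_pert hα hR₂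
      (fun z hz => hM z (Metric.ball_subset_closedBall hz)) (hsmall ε hε).1.le ht₁b))

end Confinement

/-- The superlevel set `{u > u^*(s)}` of the perturbation `f₀ + ε g`, which is the domain of
integration in `I`. -/
def optimalSet (α s : ℝ) (g : ℂ → ℂ) (ε : ℝ) : Set ℂ :=
  superlevel α (pert α g ε) (uStar α (pert α g ε) s)

/-- The integral over the optimal set of `∂u/∂ε`, a subgradient of `ε ↦ I α (f₀ + ε g) s`. -/
def slopeAt (α s : ℝ) (g : ℂ → ℂ) (ε : ℝ) : ℝ :=
  2 * c₀ α * (∫ z in optimalSet α s g ε, (g z).re * weight (α + 2) z ∂hyp) +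
    2 * ε * ∫ z in optimalSet α s g ε, ‖g z‖ ^ 2 * weight (α + 2) z ∂hyp

namespace Confined

variable {α R ε₀ R₁ t₁ ε t : ℝ} {g : ℂ → ℂ}

section Geometry

lemma radius_lt_one (h : Confined α R g ε₀ R₁ t₁) : R < 1 := h.radius_lt.trans h.outer_lt_one

lemma hypArea_radius_nonneg (h : Confined α R g ε₀ R₁ t₁) : 0 ≤ hypArea R :=
  hypArea_nonneg h.radius_pos.le h.radius_lt_one

lemma continuousOn_pert (h : Confined α R g ε₀ R₁ t₁) (ε : ℝ) : ContinuousOn (pert α g ε) disk :=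
  (differentiableOn_pert h.differentiableOn ε).continuousOn

lemma measurableSet_superlevel (h : Confined α R g ε₀ R₁ t₁) (ε t : ℝ) :
    MeasurableSet (superlevel α (pert α g ε) t) :=
  (isOpen_superlevel (h.continuousOn_pert ε) t).measurableSet

lemma superlevel_subset_closedBall (h : Confined α R g ε₀ R₁ t₁) (hε : |ε| < ε₀) (ht : t₁ ≤ t) :
    superlevel α (pert α g ε) t ⊆ Metric.closedBall 0 R₁ :=
  (superlevel_anti _ ht).trans (h.subset_closedBall ε hε)

lemma hyp_level_eq_zero (h : Confined α R g ε₀ R₁ t₁) (hε : |ε| < ε₀) (ht : t₁ < t) :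
    hyp {z | z ∈ disk ∧ u α (pert α g ε) z = t} = 0 :=
  hyp_absolutelyContinuous (volume_level_eq_zero (differentiableOn_pert h.differentiableOn ε)
    h.outer_lt_one (h.subset_closedBall ε hε) ht)

lemma exists_superlevel_eq_empty (h : Confined α R g ε₀ R₁ t₁) (hε : |ε| < ε₀) :
    ∃ t, 0 ≤ t ∧ superlevel α (pert α g ε) t = ∅ := by
  obtain ⟨M, hM⟩ := (isCompact_closedBall (0 : ℂ) R₁).exists_bound_of_continuousOn
    ((continuousOn_u (h.continuousOn_pert ε)).mono (closedBall_subset_disk h.outer_lt_one))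
  refine ⟨max M t₁, le_max_of_le_right h.level_pos.le,
    Set.eq_empty_of_forall_notMem fun z hz => ?_⟩
  have hle := hM z (h.superlevel_subset_closedBall hε (le_max_right _ _) hz)
  exact ((le_max_left _ _).trans_lt hz.2).not_ge ((le_abs_self _).trans hle)

lemma hyp_optimalSet_le (h : Confined α R g ε₀ R₁ t₁) (hε : |ε| < ε₀) :
    hyp (optimalSet α (hypArea R) g ε) ≤ ENNReal.ofReal (hypArea R) := by
  obtain ⟨t, ht0, ht⟩ := h.exists_superlevel_eq_empty hε
  have hmeasure : hyp (superlevel α (pert α g ε) t) ≤ ENNReal.ofReal (hypArea R) := by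
    rw [ht, measure_empty]
    exact zero_le
  exact measure_superlevel_sInf_le (u α (pert α g ε)) disk ⟨t, ht0, hmeasure⟩

lemma level_lt_uStar (h : Confined α R g ε₀ R₁ t₁) (hε : |ε| < ε₀) :
    t₁ < uStar α (pert α g ε) (hypArea R) := by
  by_contra! hle
  exact ((measure_mono (superlevel_anti _ hle)).trans (h.hyp_optimalSet_le hε)).not_gt
    (h.hypArea_lt ε hε)

lemma hyp_optimalSet (h : Confined α R g ε₀ R₁ t₁) (hε : |ε| < ε₀) :
    hyp (optimalSet α (hypArea R) g ε) = ENNReal.ofReal (hypArea R) :=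
  (h.hyp_optimalSet_le hε).antisymm <| le_measure_superlevel_sInf h.level_pos.le
    (h.level_lt_uStar hε) (h.measurableSet_superlevel ε)
    (hyp_ne_top h.outer_lt_one (h.subset_closedBall ε hε))
    (h.hyp_level_eq_zero hε (h.level_lt_uStar hε))

lemma measureReal_optimalSet (h : Confined α R g ε₀ R₁ t₁) (hε : |ε| < ε₀) :
    hyp.real (optimalSet α (hypArea R) g ε) = hypArea R := by
  rw [measureReal_def, h.hyp_optimalSet hε, ENNReal.toReal_ofReal h.hypArea_radius_nonneg]

lemma optimalSet_subset_closedBall (h : Confined α R g ε₀ R₁ t₁) (hε : |ε| < ε₀) :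
    optimalSet α (hypArea R) g ε ⊆ Metric.closedBall 0 R₁ :=
  h.superlevel_subset_closedBall hε (h.level_lt_uStar hε).le

lemma measurableSet_optimalSet (h : Confined α R g ε₀ R₁ t₁) (ε : ℝ) :
    MeasurableSet (optimalSet α (hypArea R) g ε) := h.measurableSet_superlevel _ _

lemma eventually_abs_lt (hε : |ε| < ε₀) : ∀ᶠ ε' in 𝓝 ε, |ε'| < ε₀ :=
  continuous_abs.continuousAt.eventually (gt_mem_nhds hε)

end Geometry

section IntegralContinuity

variable {ψ : ℂ → ℝ}

lemma exists_bound (h : Confined α R g ε₀ R₁ t₁) (hψ : ContinuousOn ψ disk) :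
    ∃ M, ∀ z ∈ Metric.closedBall 0 R₁, ‖ψ z‖ ≤ M :=
  (isCompact_closedBall (0 : ℂ) R₁).exists_bound_of_continuousOn
    (hψ.mono (closedBall_subset_disk h.outer_lt_one))

lemma integrableOn_hyp (h : Confined α R g ε₀ R₁ t₁) (hψ : ContinuousOn ψ disk) :
    IntegrableOn ψ (Metric.closedBall 0 R₁) hyp := by
  obtain ⟨M, hM⟩ := h.exists_bound hψ
  exact IntegrableOn.of_bound (hyp_ne_top h.outer_lt_one le_rfl).lt_top
    ((hψ.mono (closedBall_subset_disk h.outer_lt_one)).aestronglyMeasurable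
      measurableSet_closedBall) M
    ((ae_restrict_iff' measurableSet_closedBall).2 (ae_of_all _ hM))

/- Superlevel sets of one function are nested, so integrals over them are compared through their
measures. -/
lemma norm_integral_optimalSet_sub_le (h : Confined α R g ε₀ R₁ t₁) (hψ : ContinuousOn ψ disk)
    {M : ℝ} (hM : ∀ z ∈ Metric.closedBall 0 R₁, ‖ψ z‖ ≤ M) (hε : |ε| < ε₀) (ht : t₁ ≤ t) :
    ‖(∫ z in optimalSet α (hypArea R) g ε, ψ z ∂hyp) -
      ∫ z in superlevel α (pert α g ε) t, ψ z ∂hyp‖ ≤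
      M * |hypArea R - hyp.real (superlevel α (pert α g ε) t)| := by
  have hnested : ∀ {A B : Set ℂ}, MeasurableSet A → A ⊆ B → B ⊆ Metric.closedBall 0 R₁ →
      ‖(∫ z in B, ψ z ∂hyp) - ∫ z in A, ψ z ∂hyp‖ ≤ M * |hyp.real B - hyp.real A| :=
    fun hA hAB hB => norm_setIntegral_sub_le_of_subset hA hAB (hyp_ne_top h.outer_lt_one hB)
      ((h.integrableOn_hyp hψ).mono_set hB) fun z hz => hM z (hB hz)
  have hmeasure := h.measureReal_optimalSet hε
  rcases le_total t (uStar α (pert α g ε) (hypArea R)) with hle | hle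
  · have hbound := hnested (h.measurableSet_optimalSet ε) (superlevel_anti _ hle)
      (h.superlevel_subset_closedBall hε ht)
    rwa [hmeasure, norm_sub_rev, abs_sub_comm] at hbound
  · have hbound := hnested (B := optimalSet α (hypArea R) g ε) (h.measurableSet_superlevel ε t)
      (superlevel_anti _ hle) (h.optimalSet_subset_closedBall hε)
    rwa [hmeasure] at hbound

lemma tendsto_integral_superlevel (h : Confined α R g ε₀ R₁ t₁) (hψ : ContinuousOn ψ disk)
    (hε : |ε| < ε₀) (ht : t₁ < t) :
    Tendsto (fun ε' => ∫ z in superlevel α (pert α g ε') t, ψ z ∂hyp) (𝓝 ε)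
      (𝓝 (∫ z in superlevel α (pert α g ε) t, ψ z ∂hyp)) := by
  refine tendsto_setIntegral_of_ae_eventually_mem_iff (h.integrableOn_hyp hψ)
    (h.measurableSet_superlevel ε t) (fun ε' => h.measurableSet_superlevel ε' t)
    (h.superlevel_subset_closedBall hε ht.le)
    ((eventually_abs_lt hε).mono fun ε' hε' => h.superlevel_subset_closedBall hε' ht.le) ?_
  rw [ae_restrict_iff' measurableSet_closedBall]
  filter_upwards [measure_eq_zero_iff_ae_notMem.1 (h.hyp_level_eq_zero hε ht)] with z hz hz_ball
  have hzd := closedBall_subset_disk h.outer_lt_one hz_ball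
  have hcont := (continuous_u_pert (α := α) g z).continuousAt (x := ε)
  have hne : u α (pert α g ε) z ≠ t := fun heq => hz ⟨hzd, heq⟩
  rcases hne.lt_or_gt with hlt | hgt
  · filter_upwards [hcont.eventually (gt_mem_nhds hlt)] with ε' hlt'
    exact iff_of_false (fun hmem => hmem.2.not_gt hlt') fun hmem => hmem.2.not_gt hlt
  · filter_upwards [hcont.eventually (lt_mem_nhds hgt)] with ε' hgt'
    exact iff_of_true ⟨hzd, hgt'⟩ ⟨hzd, hgt⟩

lemma tendsto_measureReal_superlevel (h : Confined α R g ε₀ R₁ t₁) (hε : |ε| < ε₀) (ht : t₁ < t) :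
    Tendsto (fun ε' => hyp.real (superlevel α (pert α g ε') t)) (𝓝 ε)
      (𝓝 (hyp.real (superlevel α (pert α g ε) t))) := by
  simpa only [setIntegral_const, smul_eq_mul, mul_one] using
    h.tendsto_integral_superlevel (continuousOn_const (c := (1 : ℝ))) hε ht

lemma continuousAt_integral_optimalSet (h : Confined α R g ε₀ R₁ t₁) (hψ : ContinuousOn ψ disk)
    (hε : |ε| < ε₀) :
    ContinuousAt (fun ε' => ∫ z in optimalSet α (hypArea R) g ε', ψ z ∂hyp) ε := by
  obtain ⟨M, hM⟩ := h.exists_bound hψ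
  set t := uStar α (pert α g ε) (hypArea R)
  have ht : t₁ < t := h.level_lt_uStar hε
  have hmeasure : Tendsto (fun ε' => M * |hypArea R - hyp.real (superlevel α (pert α g ε') t)|)
      (𝓝 ε) (𝓝 0) := by
    have hlim := ((h.tendsto_measureReal_superlevel hε ht).const_sub (hypArea R)).abs.const_mul M
    have hlevel : hyp.real (superlevel α (pert α g ε) t) = hypArea R := h.measureReal_optimalSet hε
    rwa [hlevel, sub_self, abs_zero, mul_zero] at hlim
  have hdiff : Tendsto (fun ε' => (∫ z in optimalSet α (hypArea R) g ε', ψ z ∂hyp) -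
      ∫ z in superlevel α (pert α g ε') t, ψ z ∂hyp) (𝓝 ε) (𝓝 0) :=
    squeeze_zero_norm' ((eventually_abs_lt hε).mono fun ε' hε' =>
      h.norm_integral_optimalSet_sub_le hψ hM hε' ht.le) hmeasure
  have hsum := hdiff.add (h.tendsto_integral_superlevel hψ hε ht)
  simp only [sub_add_cancel, zero_add] at hsum
  exact hsum

end IntegralContinuity

section Envelope

lemma continuousOn_re_mul_weight (h : Confined α R g ε₀ R₁ t₁) (β : ℝ) :
    ContinuousOn (fun z => (g z).re * weight β z) disk :=
  (Complex.continuous_re.comp_continuousOn h.differentiableOn.continuousOn).mul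
    (continuousOn_weight _)

lemma continuousOn_sq_norm_mul_weight (h : Confined α R g ε₀ R₁ t₁) (β : ℝ) :
    ContinuousOn (fun z => ‖g z‖ ^ 2 * weight β z) disk :=
  (h.differentiableOn.continuousOn.norm.pow 2).mul (continuousOn_weight _)

lemma integral_u_pert (h : Confined α R g ε₀ R₁ t₁) {E : Set ℂ} (hE : E ⊆ Metric.closedBall 0 R₁)
    (ε : ℝ) :
    ∫ z in E, u α (pert α g ε) z ∂hyp = c₀ α ^ 2 * (∫ z in E, weight (α + 2) z ∂hyp) +
      2 * c₀ α * ε * (∫ z in E, (g z).re * weight (α + 2) z ∂hyp) +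
      ε ^ 2 * ∫ z in E, ‖g z‖ ^ 2 * weight (α + 2) z ∂hyp := by
  have hint : ∀ {ψ : ℂ → ℝ} (c : ℝ), ContinuousOn ψ disk →
      Integrable (fun z => c * ψ z) (hyp.restrict E) := fun c hψ =>
    ((h.integrableOn_hyp hψ).mono_set hE).const_mul c
  have hweight := hint (c₀ α ^ 2) (continuousOn_weight (α + 2))
  have hre := hint (2 * c₀ α * ε) (h.continuousOn_re_mul_weight (α + 2))
  have hsq := hint (ε ^ 2) (h.continuousOn_sq_norm_mul_weight (α + 2))
  have hsum : Integrable (fun z => c₀ α ^ 2 * weight (α + 2) z +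
      2 * c₀ α * ε * ((g z).re * weight (α + 2) z)) (hyp.restrict E) := hweight.add hre
  simp only [u_pert]
  rw [integral_add hsum hsq, integral_add hweight hre, integral_const_mul,
    integral_const_mul, integral_const_mul]

lemma integral_optimalSet_u_pert_le (h : Confined α R g ε₀ R₁ t₁) {ε' : ℝ} (hε : |ε| < ε₀)
    (hε' : |ε'| < ε₀) :
    ∫ z in optimalSet α (hypArea R) g ε, u α (pert α g ε') z ∂hyp ≤
      I α (pert α g ε') (hypArea R) := by
  have hint := h.integrableOn_hyp (continuousOn_u (α := α) (h.continuousOn_pert ε'))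
  have hfin := hyp_ne_top h.outer_lt_one (h.optimalSet_subset_closedBall hε')
  exact setIntegral_le_setIntegral_of_bathtub (t := uStar α (pert α g ε') (hypArea R))
    (h.measurableSet_optimalSet ε') (h.measurableSet_optimalSet ε) (fun z hz => hz.2.le)
    (fun z hz hz' => not_lt.1 fun hlt => hz' ⟨hz.1, hlt⟩)
    ((h.hyp_optimalSet hε').trans (h.hyp_optimalSet hε).symm) hfin
    (hint.mono_set (h.optimalSet_subset_closedBall hε'))
    (hint.mono_set (h.optimalSet_subset_closedBall hε))

lemma slopeAt_mul_le (h : Confined α R g ε₀ R₁ t₁) {ε' : ℝ} (hε : |ε| < ε₀) (hε' : |ε'| < ε₀) :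
    slopeAt α (hypArea R) g ε * (ε' - ε) ≤
      I α (pert α g ε') (hypArea R) - I α (pert α g ε) (hypArea R) := by
  have hle := h.integral_optimalSet_u_pert_le hε hε'
  have heq : I α (pert α g ε) (hypArea R) =
    ∫ z in optimalSet α (hypArea R) g ε, u α (pert α g ε) z ∂hyp := rfl
  rw [h.integral_u_pert (h.optimalSet_subset_closedBall hε)] at hle heq
  have hnonneg : 0 ≤ ∫ z in optimalSet α (hypArea R) g ε, ‖g z‖ ^ 2 * weight (α + 2) z ∂hyp :=
    setIntegral_nonneg (h.measurableSet_optimalSet ε) fun z hz =>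
      mul_nonneg (sq_nonneg _) (weight_pos _ hz.1).le
  rw [slopeAt]
  linear_combination hle + heq + mul_nonneg (sq_nonneg (ε' - ε)) hnonneg

lemma hasDerivAt_I (h : Confined α R g ε₀ R₁ t₁) (hε : |ε| < ε₀) :
    HasDerivAt (fun ε => I α (pert α g ε) (hypArea R)) (slopeAt α (hypArea R) g ε) ε := by
  refine hasDerivAt_of_subgradient ?_ ((eventually_abs_lt hε).mono fun ε' hε' =>
    ⟨h.slopeAt_mul_le hε hε', h.slopeAt_mul_le hε' hε⟩)
  exact ((h.continuousAt_integral_optimalSet (h.continuousOn_re_mul_weight _) hε).const_mul _).add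
    ((continuousAt_id.const_mul 2).mul
      (h.continuousAt_integral_optimalSet (h.continuousOn_sq_norm_mul_weight _) hε))

end Envelope

end Confined

section CircleAverageRe

variable {f : ℂ → ℂ} {c : ℂ} {r R : ℝ}

lemma circleAverage_re_of_differentiableOn_ball (hf : DifferentiableOn ℂ f (Metric.ball c R))
    (hr : 0 ≤ r) (hrR : r < R) : circleAverage (fun z => (f z).re) c r = (f c).re := by
  have hre := Complex.reCLM.circleAverage_comp_comm
    (circleIntegrable_of_continuousOn_ball hf.continuousOn hr hrR)
  rw [circleAverage_eq_of_differentiableOn_ball hf hr hrR] at hre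
  exact hre

lemma circleAverage_re_sq (hf : DifferentiableOn ℂ f (Metric.ball c R)) (hr : 0 ≤ r)
    (hrR : r < R) : circleAverage (fun z => (f z).re ^ 2) c r =
      2⁻¹ * (circleAverage (fun z => ‖f z‖ ^ 2) c r + (f c ^ 2).re) := by
  have hsq : DifferentiableOn ℂ (fun z => f z ^ 2) (Metric.ball c R) := hf.pow 2
  have hsplit : (fun z => (f z).re ^ 2) = fun z => (2⁻¹ : ℝ) • (‖f z‖ ^ 2 + (f z ^ 2).re) := by
    ext z
    rw [← Complex.normSq_eq_norm_sq, Complex.normSq_apply, pow_two (f z), Complex.mul_re,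
      smul_eq_mul]
    ring
  have hnorm : CircleIntegrable (fun z => ‖f z‖ ^ 2) c r :=
    circleIntegrable_of_continuousOn_ball (hf.continuousOn.norm.pow 2) hr hrR
  have hre : CircleIntegrable (fun z => (f z ^ 2).re) c r := circleIntegrable_of_continuousOn_ball
    (Complex.continuous_re.comp_continuousOn hsq.continuousOn) hr hrR
  rw [hsplit, circleAverage_fun_smul, smul_eq_mul, circleAverage_fun_add hnorm hre,
    circleAverage_re_of_differentiableOn_ball hsq hr hrR]

end CircleAverageRe

section LevelVariation

lemma hasDerivAt_mul_self_zero {X : ℝ → ℝ} (hX : ContinuousAt X 0) :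
    HasDerivAt (fun ε => ε * X ε) (X 0) 0 := by
  rw [hasDerivAt_iff_tendsto_slope_zero]
  refine (hX.tendsto.mono_left nhdsWithin_le_nhds).congr' ?_
  filter_upwards [self_mem_nhdsWithin] with ε (hε : ε ≠ 0)
  rw [zero_add, zero_mul, sub_zero, smul_eq_mul, inv_mul_cancel_left₀ hε]

lemma rpow_mul_sub_le {a b β : ℝ} (hb : 0 < b) (hab : b ≤ a) (hβ : 0 ≤ β) :
    b ^ β * (a - b) ≤ a ^ (β + 1) - b ^ (β + 1) := by
  have ha : 0 < a := hb.trans_le hab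
  rw [rpow_add_one ha.ne', rpow_add_one hb.ne', mul_sub]
  gcongr

lemma mul_sub_le_one_sub_sq_rpow_sub {β r r' ρ : ℝ} (hβ : 0 ≤ β) (hr : 0 ≤ r) (hrr' : r ≤ r')
    (hr'ρ : r' ≤ ρ) (hρ : ρ < 1) :
    (1 - ρ ^ 2) ^ β * (r' * (r' - r)) ≤ (1 - r ^ 2) ^ (β + 1) - (1 - r' ^ 2) ^ (β + 1) := by
  have hr' := hr.trans hrr'
  have hpos' := one_sub_sq_pos hr' (hr'ρ.trans_lt hρ)
  have hpos := one_sub_sq_pos (hr'.trans hr'ρ) hρ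
  have hsq : r' * (r' - r) ≤ 1 - r ^ 2 - (1 - r' ^ 2) := by nlinarith
  calc (1 - ρ ^ 2) ^ β * (r' * (r' - r)) ≤ (1 - r' ^ 2) ^ β * (1 - r ^ 2 - (1 - r' ^ 2)) := by
        have := mul_nonneg hr' (sub_nonneg.2 hrr')
        gcongr
    _ ≤ _ := rpow_mul_sub_le hpos' (by gcongr) hβ

lemma mul_abs_sub_le_abs_one_sub_sq_rpow_sub {β r R ρ : ℝ} (hβ : 0 ≤ β) (hr : 0 ≤ r) (hrρ : r ≤ ρ)
    (hR : 0 ≤ R) (hRρ : R ≤ ρ) (hρ : ρ < 1) :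
    (1 - ρ ^ 2) ^ β * (R * |r - R|) ≤ |(1 - r ^ 2) ^ (β + 1) - (1 - R ^ 2) ^ (β + 1)| := by
  have hpos := one_sub_sq_pos (hr.trans hrρ) hρ
  rcases le_total r R with hrR | hrR
  · rw [abs_sub_comm r, abs_of_nonneg (sub_nonneg.2 hrR)]
    exact (mul_sub_le_one_sub_sq_rpow_sub hβ hr hrR hRρ hρ).trans (le_abs_self _)
  · rw [abs_of_nonneg (sub_nonneg.2 hrR), abs_sub_comm]
    calc (1 - ρ ^ 2) ^ β * (R * (r - R)) ≤ (1 - ρ ^ 2) ^ β * (r * (r - R)) := by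
          have := sub_nonneg.2 hrR
          gcongr
      _ ≤ _ := (mul_sub_le_one_sub_sq_rpow_sub hβ hR hrR hrρ hρ).trans (le_abs_self _)

variable {α : ℝ} {g : ℂ → ℂ}

lemma abs_u_pert_sub_le (hα : -1 < α) {M ε : ℝ} {z : ℂ} (hz : z ∈ disk) (hM : ‖g z‖ ≤ M)
    (hε : |ε| ≤ 1) :
    |u α (pert α g ε) z - u α (pert α g 0) z| ≤ (2 * c₀ α * M + M ^ 2) * |ε| := by
  have hc := c₀_pos hα
  have hweight0 := weight_pos (α + 2) hz
  have hweight1 : weight (α + 2) z ≤ 1 := rpow_le_one (one_sub_sq_norm_pos hz).le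
    (sub_le_self _ (sq_nonneg _)) (by linarith)
  have hre : |(g z).re| ≤ M := (Complex.abs_re_le_norm _).trans hM
  have hfactor : u α (pert α g ε) z - u α (pert α g 0) z =
      weight (α + 2) z * (2 * c₀ α * (g z).re + ε * ‖g z‖ ^ 2) * ε := by
    rw [u_pert_zero, u_pert]
    ring
  have hbracket : |2 * c₀ α * (g z).re + ε * ‖g z‖ ^ 2| ≤ 2 * c₀ α * M + 1 * M ^ 2 := by
    refine (abs_add_le _ _).trans ?_
    rw [abs_mul (2 * c₀ α), abs_mul ε, abs_of_pos (by positivity : 0 < 2 * c₀ α),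
      abs_of_nonneg (sq_nonneg ‖g z‖)]
    gcongr
  rw [hfactor, abs_mul, abs_mul, abs_of_pos hweight0]
  gcongr
  calc weight (α + 2) z * |2 * c₀ α * (g z).re + ε * ‖g z‖ ^ 2|
      ≤ 1 * (2 * c₀ α * M + 1 * M ^ 2) := by gcongr
    _ = 2 * c₀ α * M + M ^ 2 := by ring

lemma mul_abs_norm_sub_le_abs_u_pert_zero_sub (hα : -1 < α) {R ρ : ℝ} {z : ℂ} (hR : 0 ≤ R)
    (hRρ : R ≤ ρ) (hρ : ρ < 1) (hz : ‖z‖ ≤ ρ) :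
    c₀ α ^ 2 * ((1 - ρ ^ 2) ^ (α + 1) * (R * |‖z‖ - R|)) ≤
      |u α (pert α g 0) z - baseLevel α R| := by
  rw [u_pert_zero, baseLevel, ← mul_sub, abs_mul, abs_of_nonneg (sq_nonneg (c₀ α)), weight,
    show α + 2 = α + 1 + 1 by ring]
  gcongr
  exact mul_abs_sub_le_abs_one_sub_sq_rpow_sub (by linarith) (norm_nonneg z) hz hR hRρ hρ

lemma continuousAt_comp_ray {φ : ℂ → ℝ} (hφ : ContinuousOn φ disk) {R : ℝ} (hR0 : 0 ≤ R)
    (hR1 : R < 1) (y θ : ℝ) : ContinuousAt (fun ε : ℝ => φ (circleMap 0 (R + ε * y) θ)) 0 := by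
  have hmem : circleMap 0 (R + 0 * y) θ ∈ disk := by
    rwa [zero_mul, add_zero, circleMap_mem_disk_iff hR0]
  have hray : ContinuousAt (fun ε : ℝ => circleMap 0 (R + ε * y) θ) 0 := by
    simp only [circleMap_zero]
    fun_prop
  exact ContinuousAt.comp (f := fun ε : ℝ => circleMap 0 (R + ε * y) θ)
    (hφ.continuousAt (isOpen_disk.mem_nhds hmem)) hray

/-- To first order in `ε`, the set `{u > baseLevel α R}` of `f₀ + ε g` is bounded by the curve
`r = R + ε * displacement α R g θ` in polar coordinates. -/
def displacement (α R : ℝ) (g : ℂ → ℂ) (θ : ℝ) : ℝ :=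
  (g (circleMap 0 R θ)).re * (1 - R ^ 2) / (c₀ α * (α + 2) * R)

lemma hasDerivAt_u_ray (hα : -1 < α) (hg : ContinuousOn g disk) {R : ℝ} (hR0 : 0 < R) (hR1 : R < 1)
    (y θ : ℝ) :
    HasDerivAt (fun ε => u α (pert α g ε) (circleMap 0 (R + ε * y) θ))
      (2 * c₀ α ^ 2 * (α + 2) * R * (1 - R ^ 2) ^ (α + 1) * (displacement α R g θ - y)) 0 := by
  have hpos := one_sub_sq_pos hR0.le hR1
  have hlinear : HasDerivAt (fun ε : ℝ => R + ε * y) y 0 := by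
    simpa only [id_eq, one_mul] using ((hasDerivAt_id (0 : ℝ)).mul_const y).const_add R
  have hweight : HasDerivAt (fun ε : ℝ => (1 - (R + ε * y) ^ 2) ^ (α + 2))
      (-(2 * R) * (α + 2) * (1 - R ^ 2) ^ (α + 2 - 1) * y) 0 :=
    HasDerivAt.comp (h₂ := fun r : ℝ => (1 - r ^ 2) ^ (α + 2)) 0
      (by simpa only [zero_mul, add_zero] using hasDerivAt_one_sub_sq_rpow (α + 2) hpos) hlinear
  have hcont : ContinuousAt (fun ε : ℝ => 2 * c₀ α * ((g (circleMap 0 (R + ε * y) θ)).re *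
      weight (α + 2) (circleMap 0 (R + ε * y) θ)) +
      ε * (‖g (circleMap 0 (R + ε * y) θ)‖ ^ 2 * weight (α + 2) (circleMap 0 (R + ε * y) θ))) 0 :=
    ((continuousAt_comp_ray ((Complex.continuous_re.comp_continuousOn hg).mul
      (continuousOn_weight (α + 2))) hR0.le hR1 y θ).const_mul _).add
      (continuousAt_id.mul (continuousAt_comp_ray ((hg.norm.pow 2).mul
        (continuousOn_weight (α + 2))) hR0.le hR1 y θ))
  have hsum := (hweight.const_mul (c₀ α ^ 2)).add (hasDerivAt_mul_self_zero hcont)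
  convert! hsum using 1
  · ext ε
    rw [u_pert]
    simp only [weight, norm_circleMap_zero, sq_abs, Pi.add_apply]
    ring
  · have := (c₀_pos hα).ne'
    have : α + 2 ≠ 0 := by linarith
    have hrpow : (1 - R ^ 2) ^ (α + 2) = (1 - R ^ 2) ^ (α + 1) * (1 - R ^ 2) := by
      rw [← rpow_add_one hpos.ne', show α + 1 + 1 = α + 2 by ring]
    simp only [zero_mul, add_zero, weight, norm_circleMap_zero, sq_abs, displacement, hrpow,
      show α + 2 - 1 = α + 1 by ring]
    field_simp
    ring

end LevelVariation

namespace Confined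

variable {α R ε₀ R₁ t₁ : ℝ} {g : ℂ → ℂ} {ψ : ℂ → ℝ}

lemma abs_zero_lt (h : Confined α R g ε₀ R₁ t₁) : |(0 : ℝ)| < ε₀ := by
  rw [abs_zero]
  exact h.range_pos

lemma ball_subset_closedBall (h : Confined α R g ε₀ R₁ t₁) :
    Metric.ball (0 : ℂ) R ⊆ Metric.closedBall 0 R₁ :=
  (Metric.ball_subset_ball h.radius_lt.le).trans Metric.ball_subset_closedBall

lemma superlevel_zero (h : Confined α R g ε₀ R₁ t₁) :
    superlevel α (pert α g 0) (baseLevel α R) = Metric.ball 0 R :=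
  superlevel_pert_zero h.weight_exponent g h.radius_pos.le h.radius_lt_one

section FirstVariation

/- A point in exactly one of `{u > b}` and the disk is one where the perturbation moves `u` across
the level `b`, and the unperturbed `u` crosses `b` at a positive rate. -/
lemma exists_thin (h : Confined α R g ε₀ R₁ t₁) :
    ∃ C, 0 ≤ C ∧ ∀ᶠ ε in 𝓝 (0 : ℝ), ∀ z,
      ¬(z ∈ superlevel α (pert α g ε) (baseLevel α R) ↔ z ∈ Metric.ball (0 : ℂ) R) →
        |‖z‖ - R| ≤ C * |ε| := by
  have hR := h.radius_pos
  have hRR₁ := h.radius_lt.le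
  obtain ⟨M, hM⟩ := (isCompact_closedBall (0 : ℂ) R₁).exists_bound_of_continuousOn
    (h.differentiableOn.continuousOn.mono (closedBall_subset_disk h.outer_lt_one))
  have hM0 : 0 ≤ M := (norm_nonneg _).trans (hM 0 (Metric.mem_closedBall_self (hR.le.trans hRR₁)))
  have hc := c₀_pos h.weight_exponent
  have hR₁w := one_sub_sq_pos (hR.le.trans hRR₁) h.outer_lt_one
  have hk : 0 < c₀ α ^ 2 * ((1 - R₁ ^ 2) ^ (α + 1) * R) := by positivity
  refine ⟨(2 * c₀ α * M + M ^ 2) / (c₀ α ^ 2 * ((1 - R₁ ^ 2) ^ (α + 1) * R)), by positivity, ?_⟩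
  filter_upwards [eventually_abs_lt h.abs_zero_lt,
    eventually_abs_lt ((abs_zero (α := ℝ)).trans_lt one_pos)] with ε hε hε1 z hz
  have hzR₁ : z ∈ Metric.closedBall (0 : ℂ) R₁ := by
    by_contra hnot
    exact hz (iff_of_false
      (fun hmem => hnot (h.superlevel_subset_closedBall hε h.level_lt.le hmem))
      fun hmem => hnot (h.ball_subset_closedBall hmem))
  have hzd := closedBall_subset_disk h.outer_lt_one hzR₁
  have hcross : |u α (pert α g 0) z - baseLevel α R| ≤
      |u α (pert α g ε) z - u α (pert α g 0) z| := by
    have hlt : ¬(baseLevel α R < u α (pert α g ε) z ↔ baseLevel α R < u α (pert α g 0) z) := by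
      rw [← h.superlevel_zero] at hz
      exact fun hiff => hz (and_congr_right fun _ => hiff)
    grind
  rw [div_mul_eq_mul_div, le_div_iff₀ hk]
  calc |‖z‖ - R| * (c₀ α ^ 2 * ((1 - R₁ ^ 2) ^ (α + 1) * R))
      = c₀ α ^ 2 * ((1 - R₁ ^ 2) ^ (α + 1) * (R * |‖z‖ - R|)) := by ring
    _ ≤ |u α (pert α g 0) z - baseLevel α R| := mul_abs_norm_sub_le_abs_u_pert_zero_sub
        h.weight_exponent hR.le hRR₁ h.outer_lt_one (mem_closedBall_zero_iff.1 hzR₁)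
    _ ≤ _ := hcross.trans (abs_u_pert_sub_le h.weight_exponent hzd (hM z hzR₁) hε1.le)

lemma eventually_ray_mem_superlevel_iff (h : Confined α R g ε₀ R₁ t₁) {y θ : ℝ}
    (hy : y ≠ displacement α R g θ) :
    ∀ᶠ ε in 𝓝[≠] (0 : ℝ), (circleMap 0 (R + ε * y) θ ∈
      superlevel α (pert α g ε) (baseLevel α R) ↔ ε * y < ε * displacement α R g θ) := by
  have hα := h.weight_exponent
  have hα2 : 0 < α + 2 := by linarith
  have hR := h.radius_pos
  have hc := c₀_pos hα
  have hpos := one_sub_sq_pos hR.le h.radius_lt_one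
  set k := 2 * c₀ α ^ 2 * (α + 2) * R * (1 - R ^ 2) ^ (α + 1)
  have hk : 0 < k := by positivity
  have hderiv := hasDerivAt_u_ray hα h.differentiableOn.continuousOn hR h.radius_lt_one y θ
  have hzero : u α (pert α g 0) (circleMap 0 (R + 0 * y) θ) = baseLevel α R := by
    rw [u_pert_zero, zero_mul, add_zero, weight, norm_circleMap_zero, sq_abs, baseLevel]
  have hradius : ContinuousAt (fun ε : ℝ => R + ε * y) 0 := by fun_prop
  have hinside : ∀ᶠ ε in 𝓝 (0 : ℝ), R + ε * y ∈ Set.Ioo 0 1 :=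
    hradius.eventually (Ioo_mem_nhds (by simpa using hR) (by simpa using h.radius_lt_one))
  have hcross := eventually_lt_iff_of_hasDerivAt hderiv
    (mul_ne_zero hk.ne' (sub_ne_zero.2 hy.symm))
  filter_upwards [hcross, hinside.filter_mono nhdsWithin_le_nhds] with ε hiff hε
  rw [hzero] at hiff
  have hmem := (circleMap_mem_disk_iff hε.1.le θ).2 hε.2
  rw [superlevel, Set.mem_ofPred_eq, and_iff_right hmem, hiff, mul_left_comm,
    mul_pos_iff_of_pos_left hk, mul_sub, sub_pos]

lemma hasDerivAt_integral_superlevel (h : Confined α R g ε₀ R₁ t₁) (hψ : ContinuousOn ψ disk) :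
    HasDerivAt (fun ε => ∫ z in superlevel α (pert α g ε) (baseLevel α R), ψ z ∂hyp)
      (R * ((1 - R ^ 2) ^ 2)⁻¹ *
        ∫ θ in Set.Ioo (-π) π, ψ (circleMap 0 R θ) * displacement α R g θ) 0 := by
  obtain ⟨C, hC0, hthin⟩ := h.exists_thin
  have hderiv := hasDerivAt_setIntegral_of_moving_boundary h.radius_pos h.radius_lt_one hC0
    (continuousOn_density.mul hψ) (fun ε => h.measurableSet_superlevel ε (baseLevel α R))
    (fun ε => superlevel_subset_disk _ _) h.superlevel_zero hthin
    (fun θ y hy => h.eventually_ray_mem_superlevel_iff hy)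
  simp only [setIntegral_hyp (h.measurableSet_superlevel _ _) (superlevel_subset_disk _ _)]
  rw [← integral_const_mul]
  convert! hderiv using 1
  refine integral_congr_ae (ae_of_all _ fun θ => ?_)
  simp only [Pi.mul_apply, density, norm_circleMap_zero, sq_abs]
  ring

lemma measureReal_ball (h : Confined α R g ε₀ R₁ t₁) :
    hyp.real (Metric.ball 0 R) = hypArea R := by
  rw [measureReal_def, hyp_ball h.radius_pos.le h.radius_lt_one,
    ENNReal.toReal_ofReal h.hypArea_radius_nonneg]

lemma integral_optimalSet_zero (h : Confined α R g ε₀ R₁ t₁) (hψ : ContinuousOn ψ disk) :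
    ∫ z in optimalSet α (hypArea R) g 0, ψ z ∂hyp = ∫ z in Metric.ball 0 R, ψ z ∂hyp := by
  obtain ⟨M, hM⟩ := h.exists_bound hψ
  have hle := h.norm_integral_optimalSet_sub_le hψ hM h.abs_zero_lt h.level_lt.le
  rw [h.superlevel_zero, h.measureReal_ball, sub_self, abs_zero, mul_zero] at hle
  exact sub_eq_zero.1 (norm_le_zero_iff.1 hle)

/- At fixed level the area is stationary, so fixing the area instead of the level does not change
the derivative. -/
lemma hasDerivAt_integral_optimalSet (h : Confined α R g ε₀ R₁ t₁)
    (hdisp : ∫ θ in Set.Ioo (-π) π, displacement α R g θ = 0) (hψ : ContinuousOn ψ disk) :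
    HasDerivAt (fun ε => ∫ z in optimalSet α (hypArea R) g ε, ψ z ∂hyp)
      (R * ((1 - R ^ 2) ^ 2)⁻¹ *
        ∫ θ in Set.Ioo (-π) π, ψ (circleMap 0 R θ) * displacement α R g θ) 0 := by
  obtain ⟨M, hM⟩ := h.exists_bound hψ
  have harea := h.hasDerivAt_integral_superlevel (continuousOn_const (c := (1 : ℝ)))
  simp only [one_mul, hdisp, mul_zero, setIntegral_const, smul_eq_mul, mul_one] at harea
  have hdiff : HasDerivAt (fun ε => (∫ z in optimalSet α (hypArea R) g ε, ψ z ∂hyp) -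
      ∫ z in superlevel α (pert α g ε) (baseLevel α R), ψ z ∂hyp) 0 0 := by
    rw [hasDerivAt_iff_isLittleO] at harea ⊢
    simp only [smul_zero, sub_zero, h.superlevel_zero, h.measureReal_ball,
      h.integral_optimalSet_zero hψ, sub_self] at harea ⊢
    refine (Asymptotics.IsBigO.of_bound M ?_).trans_isLittleO harea
    filter_upwards [eventually_abs_lt h.abs_zero_lt] with ε hε
    rw [Real.norm_eq_abs (_ - hypArea R), abs_sub_comm _ (hypArea R)]
    exact h.norm_integral_optimalSet_sub_le hψ hM hε h.level_lt.le
  simpa only [Pi.add_def, sub_add_cancel, zero_add] using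
    hdiff.add (h.hasDerivAt_integral_superlevel hψ)

end FirstVariation

end Confined

/-- Half the second derivative at `0` of `ε ↦ I α (f₀ + ε g) (hypArea R)` when `g 0 = 0`. The first
term comes from the motion of the boundary of the superlevel set. -/
def quadraticForm (α R : ℝ) (g : ℂ → ℂ) : ℝ :=
  π * (1 - R ^ 2) ^ (α + 1) / (α + 2) * circleAverage (fun z => ‖g z‖ ^ 2) 0 R +
    ∫ z in Metric.ball 0 R, ‖g z‖ ^ 2 * weight α z

lemma setIntegral_hyp_ball_mul_weight_add_two {R : ℝ} (hR : R < 1) (φ : ℂ → ℝ) (β : ℝ) :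
    ∫ z in Metric.ball 0 R, φ z * weight (β + 2) z ∂hyp =
      ∫ z in Metric.ball 0 R, φ z * weight β z := by
  have hsub : Metric.ball 0 R ⊆ disk := Metric.ball_subset_ball hR.le
  rw [setIntegral_hyp measurableSet_ball hsub]
  refine setIntegral_congr_fun measurableSet_ball fun z hz => ?_
  rw [mul_left_comm, density_mul_weight_add_two β (hsub hz)]

namespace Confined

variable {α R ε₀ R₁ t₁ : ℝ} {g : ℂ → ℂ}

lemma integral_displacement (h : Confined α R g ε₀ R₁ t₁) (hg_zero : g 0 = 0) :
    ∫ θ in Set.Ioo (-π) π, displacement α R g θ = 0 := by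
  have hre := integral_Ioo_circleMap_eq_circleAverage (fun z => (g z).re) R
  rw [circleAverage_re_of_differentiableOn_ball h.differentiableOn h.radius_pos.le h.radius_lt_one,
    hg_zero, Complex.zero_re, smul_zero] at hre
  simp only [displacement, mul_div_assoc]
  rw [integral_mul_const, hre, zero_mul]

lemma integral_re_mul_weight_mul_displacement (h : Confined α R g ε₀ R₁ t₁) (hg_zero : g 0 = 0) :
    ∫ θ in Set.Ioo (-π) π, (g (circleMap 0 R θ)).re * weight (α + 2) (circleMap 0 R θ) *
        displacement α R g θ =
      π * (1 - R ^ 2) ^ (α + 3) / (c₀ α * (α + 2) * R) *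
        circleAverage (fun z => ‖g z‖ ^ 2) 0 R := by
  have hsq := integral_Ioo_circleMap_eq_circleAverage (fun z => (g z).re ^ 2) R
  rw [circleAverage_re_sq h.differentiableOn h.radius_pos.le h.radius_lt_one, hg_zero] at hsq
  have hfactor : ∀ θ, (g (circleMap 0 R θ)).re * weight (α + 2) (circleMap 0 R θ) *
      displacement α R g θ = (1 - R ^ 2) ^ (α + 3) / (c₀ α * (α + 2) * R) *
        (g (circleMap 0 R θ)).re ^ 2 := fun θ => by
    rw [displacement, weight, norm_circleMap_zero, sq_abs, show α + 3 = α + 2 + 1 by ring,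
      rpow_add_one (one_sub_sq_pos h.radius_pos.le h.radius_lt_one).ne']
    ring
  simp only [hfactor]
  rw [integral_const_mul, hsq, zero_pow two_ne_zero, Complex.zero_re, smul_eq_mul]
  ring

lemma hasDerivAt_slopeAt (h : Confined α R g ε₀ R₁ t₁) (hg_zero : g 0 = 0) :
    HasDerivAt (slopeAt α (hypArea R) g) (2 * quadraticForm α R g) 0 := by
  have hpos := one_sub_sq_pos h.radius_pos.le h.radius_lt_one
  have hlinear := h.hasDerivAt_integral_optimalSet (h.integral_displacement hg_zero)
    (h.continuousOn_re_mul_weight (α + 2))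
  have hquadratic := hasDerivAt_mul_self_zero
    (h.continuousAt_integral_optimalSet (h.continuousOn_sq_norm_mul_weight (α + 2)) h.abs_zero_lt)
  convert! (hlinear.const_mul (2 * c₀ α)).add (hquadratic.const_mul 2) using 1
  · ext ε
    rw [slopeAt, Pi.add_apply, mul_assoc 2 ε]
  · have := (c₀_pos h.weight_exponent).ne'
    have := h.radius_pos.ne'
    have hrpow : (1 - R ^ 2) ^ (α + 3) = (1 - R ^ 2) ^ (α + 1) * (1 - R ^ 2) ^ 2 := by
      rw [← rpow_two (1 - R ^ 2), ← rpow_add hpos, show α + 1 + 2 = α + 3 by ring]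
    rw [h.integral_re_mul_weight_mul_displacement hg_zero, hrpow,
      h.integral_optimalSet_zero (h.continuousOn_sq_norm_mul_weight (α + 2)),
      setIntegral_hyp_ball_mul_weight_add_two h.radius_lt_one, quadraticForm]
    field_simp

lemma I_pert_zero (h : Confined α R g ε₀ R₁ t₁) :
    I α (pert α g 0) (hypArea R) = 1 - (1 - R ^ 2) ^ (α + 1) := by
  have hα1 : α + 1 ≠ 0 := by linarith [h.weight_exponent]
  change ∫ z in optimalSet α (hypArea R) g 0, u α (pert α g 0) z ∂hyp = _
  rw [h.integral_optimalSet_zero (continuousOn_u (h.continuousOn_pert 0))]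
  simp only [u_pert_zero]
  rw [setIntegral_hyp_ball_mul_weight_add_two h.radius_lt_one, integral_const_mul,
    integral_weight_ball h.weight_exponent h.radius_pos.le h.radius_lt_one.le,
    c₀_sq h.weight_exponent]
  field_simp

end Confined

/-- The ratio by which the extremal direction `g = z²` multiplies its squared norm in
`quadraticForm`: the moment of `r ^ 5 * (1 - r ^ 2) ^ α` over `(0, R)`, plus the boundary term,
divided by the moment over `(0, 1)`. -/
def momentRatio (α R : ℝ) : ℝ :=
  1 - (1 - R ^ 2) ^ (α + 1) - (α + 1) / 2 * (1 - R ^ 2) ^ (α + 1) * (R ^ 2 * (2 - R ^ 2))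

section MomentRatio

variable {α R : ℝ}

lemma momentRatio_mul_integral (hα : -1 < α) (hR0 : 0 ≤ R) (hR1 : R < 1) :
    momentRatio α R * ∫ r in Set.Ioo (0 : ℝ) 1, r ^ 5 * (1 - r ^ 2) ^ α =
      (∫ r in Set.Ioo 0 R, r ^ 5 * (1 - r ^ 2) ^ α) +
        (1 - R ^ 2) ^ (α + 1) * R ^ 4 / (2 * (α + 2)) := by
  have hα1 : α + 1 ≠ 0 := by linarith
  have hα2 : α + 2 ≠ 0 := by linarith
  have hα3 : α + 3 ≠ 0 := by linarith
  rw [(integral_Ioo_pow_five_mul_one_sub_sq_rpow hα hR0 hR1.le).2,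
    (integral_Ioo_pow_five_mul_one_sub_sq_rpow hα zero_le_one le_rfl).2, momentRatio, one_pow,
    sub_self, zero_rpow hα1]
  field_simp
  ring

lemma momentRatio_le_one (hα : -1 < α) (hR0 : 0 ≤ R) (hR1 : R < 1) : momentRatio α R ≤ 1 := by
  have := one_sub_sq_pos hR0 hR1
  have : 0 < 2 - R ^ 2 := by linarith
  have : 0 < α + 1 := by linarith
  rw [momentRatio, sub_sub]
  exact sub_le_self _ (by positivity)

lemma pow_five_mul_one_sub_sq_rpow_pos {r : ℝ} (hr : r ∈ Set.Ioo (0 : ℝ) 1) :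
    0 < r ^ 5 * (1 - r ^ 2) ^ α :=
  mul_pos (pow_pos hr.1 5) (rpow_pos_of_pos (one_sub_sq_pos hr.1.le hr.2) α)

lemma momentRatio_nonneg (hα : -1 < α) (hR0 : 0 ≤ R) (hR1 : R < 1) : 0 ≤ momentRatio α R := by
  have := one_sub_sq_pos hR0 hR1
  have : 0 < α + 2 := by linarith
  have htotal : 0 < ∫ r in Set.Ioo (0 : ℝ) 1, r ^ 5 * (1 - r ^ 2) ^ α :=
    setIntegral_Ioo_pos one_pos
      (integral_Ioo_pow_five_mul_one_sub_sq_rpow hα zero_le_one le_rfl).1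
      fun r hr => pow_five_mul_one_sub_sq_rpow_pos hr
  have hpartial : 0 ≤ ∫ r in Set.Ioo 0 R, r ^ 5 * (1 - r ^ 2) ^ α :=
    setIntegral_nonneg measurableSet_Ioo fun r hr =>
      (pow_five_mul_one_sub_sq_rpow_pos ⟨hr.1, hr.2.trans hR1⟩).le
  refine nonneg_of_mul_nonneg_left ?_ htotal
  rw [momentRatio_mul_integral hα hR0 hR1]
  positivity

end MomentRatio

lemma setIntegral_mul_add_mul_le_of_monotoneOn {w N : ℝ → ℝ} {a b R β κ : ℝ}
    (hR : R ∈ Set.Ioo a b) (hN : MonotoneOn N (Set.Ioo a b)) (hw : ∀ r ∈ Set.Ioo a b, 0 ≤ w r)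
    (hw_int : IntegrableOn w (Set.Ioo a b))
    (hwN_int : IntegrableOn (fun r => w r * N r) (Set.Ioo a b)) (hκ0 : 0 ≤ κ) (hκ1 : κ ≤ 1)
    (hκ : κ * ∫ r in Set.Ioo a b, w r = (∫ r in Set.Ioo a R, w r) + β) :
    (∫ r in Set.Ioo a R, w r * N r) + β * N R ≤ κ * ∫ r in Set.Ioo a b, w r * N r := by
  have hsub : Set.Ioo a R ⊆ Set.Ioo a b := Set.Ioo_subset_Ioo_right hR.2.le
  set excess := fun r => w r * N r - w r * N R
  have hint : IntegrableOn excess (Set.Ioo a b) := hwN_int.sub (hw_int.mul_const (N R))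
  have hexcess : ∀ s ⊆ Set.Ioo a b, ∫ r in s, excess r =
      (∫ r in s, w r * N r) - (∫ r in s, w r) * N R := fun s hs => by
    rw [integral_sub (hwN_int.mono_set hs) ((hw_int.mono_set hs).mul_const (N R)),
      integral_mul_const]
  have hinner : ∫ r in Set.Ioo a R, excess r ≤ 0 :=
    setIntegral_nonpos measurableSet_Ioo fun r hr => sub_nonpos.2 <|
      mul_le_mul_of_nonneg_left (hN (hsub hr) hR hr.2.le) (hw r (hsub hr))
  have houter : 0 ≤ ∫ r in Set.Ioo a b \ Set.Ioo a R, excess r :=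
    setIntegral_nonneg (measurableSet_Ioo.diff measurableSet_Ioo) fun r hr => sub_nonneg.2 <|
      mul_le_mul_of_nonneg_left (hN hR hr.1 (not_lt.1 fun h => hr.2 ⟨hr.1.1, h⟩)) (hw r hr.1)
  rw [setIntegral_sdiff measurableSet_Ioo hint hsub, sub_nonneg] at houter
  have hle : ∫ r in Set.Ioo a R, excess r ≤ κ * ∫ r in Set.Ioo a b, excess r :=
    (le_mul_of_le_one_left hinner hκ1).trans (mul_le_mul_of_nonneg_left houter hκ0)
  rw [hexcess _ hsub, hexcess _ subset_rfl, mul_sub, ← mul_assoc, hκ, add_mul] at hle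
  linarith

lemma circleAverage_sq_norm_pow_mul (n : ℕ) (h : ℂ → ℂ) {r : ℝ} (hr : 0 ≤ r) :
    circleAverage (fun z => ‖z ^ n * h z‖ ^ 2) 0 r =
      (r ^ n) ^ 2 * circleAverage (fun z => ‖h z‖ ^ 2) 0 r := by
  simpa only [norm_mul, norm_pow, mul_pow, smul_eq_mul] using
    circleAverage_radial_smul (fun z => ‖h z‖ ^ 2) (fun r => (r ^ n) ^ 2) hr

lemma smul_circleAverage_sq_norm_sq_mul_weight (α : ℝ) (h : ℂ → ℂ) {r : ℝ} (hr : 0 ≤ r) :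
    (2 * π * r) • circleAverage (fun z => ‖z ^ 2 * h z‖ ^ 2 * weight α z) 0 r =
      2 * π * (r ^ 5 * (1 - r ^ 2) ^ α * circleAverage (fun z => ‖h z‖ ^ 2) 0 r) := by
  have hradial := circleAverage_radial_smul (fun z => ‖z ^ 2 * h z‖ ^ 2)
    (fun r => (1 - r ^ 2) ^ α) hr
  simp only [smul_eq_mul, mul_comm ((1 - ‖_‖ ^ 2) ^ α)] at hradial
  simp only [weight]
  rw [hradial, circleAverage_sq_norm_pow_mul 2 h hr, smul_eq_mul]
  ring

section RadialProfile

variable {α ρ : ℝ} {h : ℂ → ℂ}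

lemma setIntegral_ball_sq_norm_sq_mul_mul_weight
    (hint : IntegrableOn (fun z => ‖z ^ 2 * h z‖ ^ 2 * weight α z) (Metric.ball 0 ρ)) :
    ∫ z in Metric.ball 0 ρ, ‖z ^ 2 * h z‖ ^ 2 * weight α z =
      2 * π * ∫ r in Set.Ioo 0 ρ,
        r ^ 5 * (1 - r ^ 2) ^ α * circleAverage (fun z => ‖h z‖ ^ 2) 0 r := by
  rw [setIntegral_ball_eq_integral_circleAverage hint, ← integral_const_mul]
  exact setIntegral_congr_fun measurableSet_Ioo fun r hr =>
    smul_circleAverage_sq_norm_sq_mul_weight α h hr.1.le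

lemma integrableOn_Ioo_pow_five_mul_circleAverage
    (hint : IntegrableOn (fun z => ‖z ^ 2 * h z‖ ^ 2 * weight α z) (Metric.ball 0 ρ)) :
    IntegrableOn
      (fun r => r ^ 5 * (1 - r ^ 2) ^ α * circleAverage (fun z => ‖h z‖ ^ 2) 0 r)
      (Set.Ioo 0 ρ) := by
  refine IntegrableOn.congr_fun ((integrableOn_Ioo_circleAverage hint).const_mul (2 * π)⁻¹)
    (fun r hr => ?_) measurableSet_Ioo
  rw [smul_circleAverage_sq_norm_sq_mul_weight α h hr.1.le,
    inv_mul_cancel_left₀ two_pi_pos.ne']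

end RadialProfile

lemma quadraticForm_le {α R : ℝ} (hα : -1 < α) (hR0 : 0 < R) (hR1 : R < 1) {g h : ℂ → ℂ}
    (hg : g ∈ space α) (hh : DifferentiableOn ℂ h disk) (hgh : ∀ z, g z = z ^ 2 * h z) :
    quadraticForm α R g ≤ momentRatio α R * norm α g ^ 2 := by
  obtain rfl : g = fun z => z ^ 2 * h z := funext hgh
  have hint : IntegrableOn (fun z => ‖z ^ 2 * h z‖ ^ 2 * weight α z) (Metric.ball 0 1) := hg.2
  have hmono : MonotoneOn (circleAverage (fun z => ‖h z‖ ^ 2) 0) (Set.Ioo 0 1) :=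
    fun r hr r' hr' hrr' => circleAverage_sq_norm_mono hh hr.1.le hrr' hr'.2
  have hradial := setIntegral_mul_add_mul_le_of_monotoneOn ⟨hR0, hR1⟩ hmono
    (fun r hr => (pow_five_mul_one_sub_sq_rpow_pos (α := α) hr).le)
    (integral_Ioo_pow_five_mul_one_sub_sq_rpow hα zero_le_one le_rfl).1
    (integrableOn_Ioo_pow_five_mul_circleAverage hint) (momentRatio_nonneg hα hR0.le hR1)
    (momentRatio_le_one hα hR0.le hR1) (momentRatio_mul_integral hα hR0.le hR1)
  rw [norm_sq, disk, quadraticForm, setIntegral_ball_sq_norm_sq_mul_mul_weight hint,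
    setIntegral_ball_sq_norm_sq_mul_mul_weight
      (hint.mono_set (Metric.ball_subset_ball hR1.le)),
    circleAverage_sq_norm_pow_mul 2 h hR0.le]
  have hα2 : α + 2 ≠ 0 := by linarith
  calc _ = 2 * π * ((∫ r in Set.Ioo 0 R,
          r ^ 5 * (1 - r ^ 2) ^ α * circleAverage (fun z => ‖h z‖ ^ 2) 0 r) +
        (1 - R ^ 2) ^ (α + 1) * R ^ 4 / (2 * (α + 2)) *
          circleAverage (fun z => ‖h z‖ ^ 2) 0 R) := by
        field_simp
        ring
    _ ≤ _ := mul_le_mul_of_nonneg_left hradial two_pi_pos.le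
    _ = _ := mul_left_comm _ _ _

lemma hasDerivAt_deriv_div_one_add_sq_mul {F D : ℝ → ℝ} {c d : ℝ} (hc : 0 ≤ c)
    (hF : ∀ᶠ ε in 𝓝 (0 : ℝ), HasDerivAt F (D ε) ε) (hD : HasDerivAt D d 0) :
    (∀ᶠ ε in 𝓝 (0 : ℝ), DifferentiableAt ℝ (fun ε => F ε / (1 + ε ^ 2 * c)) ε) ∧
      HasDerivAt (deriv fun ε => F ε / (1 + ε ^ 2 * c)) (d - 2 * c * F 0) 0 := by
  have hq : ∀ ε : ℝ, HasDerivAt (fun ε : ℝ => 1 + ε ^ 2 * c) (2 * ε * c) ε := fun ε => by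
    simpa using ((hasDerivAt_pow 2 ε).mul_const c).const_add 1
  have hne : ∀ ε : ℝ, 1 + ε ^ 2 * c ≠ 0 := fun ε => by positivity
  have hquot : ∀ᶠ ε in 𝓝 (0 : ℝ), HasDerivAt (fun ε => F ε / (1 + ε ^ 2 * c))
      ((D ε * (1 + ε ^ 2 * c) - F ε * (2 * ε * c)) / (1 + ε ^ 2 * c) ^ 2) ε :=
    hF.mono fun ε hε => hε.div (hq ε) (hne ε)
  refine ⟨hquot.mono fun ε hε => hε.differentiableAt,
    HasDerivAt.congr_of_eventuallyEq ?_ (hquot.mono fun ε hε => hε.deriv)⟩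
  have hlin : HasDerivAt (fun ε : ℝ => 2 * ε * c) (2 * c) 0 := by
    simpa using ((hasDerivAt_id (0 : ℝ)).const_mul 2).mul_const c
  convert! ((hD.mul (hq 0)).sub (hF.self_of_nhds.mul hlin)).div ((hq 0).pow 2)
    (pow_ne_zero 2 (hne 0)) using 1
  simp only [Pi.mul_apply, Pi.sub_apply, Pi.pow_apply]
  ring

lemma exists_hypArea_eq {s : ℝ} (hs : 0 < s) :
    ∃ R, 0 < R ∧ R < 1 ∧ R ^ 2 = s / (π + s) ∧ hypArea R = s := by
  have hπs : 0 < π + s := by positivity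
  have hsq : √(s / (π + s)) ^ 2 = s / (π + s) := sq_sqrt (by positivity)
  refine ⟨√(s / (π + s)), sqrt_pos.2 (by positivity), ?_, hsq, ?_⟩
  · rw [sqrt_lt' one_pos, one_pow, div_lt_one hπs]
    linarith [pi_pos]
  · rw [hypArea, hsq, one_sub_div hπs.ne', add_sub_cancel_right]
    field_simp

lemma momentRatio_sub_eq {α s R : ℝ} (hs : 0 < s) (hR : R ^ 2 = s / (π + s)) :
    momentRatio α R - (1 - (1 - R ^ 2) ^ (α + 1)) =
      -((α + 1) * π ^ (α + 1) / 2 * s * (π + s) ^ (-3 - α) * (s + 2 * π)) := by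
  have hπs : 0 < π + s := by positivity
  have hone_sub : 1 - R ^ 2 = π / (π + s) := by
    rw [hR, one_sub_div hπs.ne', add_sub_cancel_right]
  have hrpow : (π + s) ^ (-3 - α) = ((π + s) ^ (α + 1))⁻¹ * ((π + s) ^ 2)⁻¹ := by
    rw [← rpow_two, ← rpow_neg hπs.le, ← rpow_neg hπs.le, ← rpow_add hπs]
    ring_nf
  rw [momentRatio, hone_sub, div_rpow pi_pos.le hπs.le, hrpow, hR]
  field_simp
  ring

lemma KLine_eq {α : ℝ} (hα : -1 < α) {g : ℂ → ℂ} (hg : g ∈ space α)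
    (hg_one : scalar α g (fun _ => 1) = 0) (s : ℝ) :
    KLine α s g = fun ε => I α (pert α g ε) s / (1 + ε ^ 2 * norm α g ^ 2) := by
  ext ε
  rw [← norm_sq_pert hα hg hg_one ε]
  rfl

end Bergman

end

theorem mainTheorem7 (α : ℝ) (hα : -1 < α) (s : ℝ) (hs : 0 < s)
    (g : ℂ → ℂ) (hg : g ∈ Bergman.space α) (hnorm : Bergman.norm α g = 1)
    (hg_one : Bergman.scalar α g (fun _ => 1) = 0)
    (hg_id : Bergman.scalar α g (fun z => z) = 0) :
    Bergman.HasSecondVariation α s g ∧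
      (1 / 2 : ℝ) * Bergman.secondVariation α s g ≤
        -((α + 1) * Real.pi ^ (α + 1) / 2 * s * (Real.pi + s) ^ (-3 - α) *
          (s + 2 * Real.pi)) := by
  obtain ⟨R, hR0, hR1, hR2, rfl⟩ := Bergman.exists_hypArea_eq hs
  obtain ⟨ε₀, R₁, t₁, hconf⟩ := Bergman.exists_confined hα hg hR0 hR1
  obtain ⟨h, hh, hgh⟩ := Bergman.exists_eq_sq_mul hα hg hg_one hg_id
  have hg_zero : g 0 = 0 := by rw [hgh, zero_pow two_ne_zero, zero_mul]
  obtain ⟨hdiff, hderiv⟩ := Bergman.hasDerivAt_deriv_div_one_add_sq_mul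
    (sq_nonneg (Bergman.norm α g))
    ((Bergman.Confined.eventually_abs_lt hconf.abs_zero_lt).mono fun _ => hconf.hasDerivAt_I)
    (hconf.hasDerivAt_slopeAt hg_zero)
  rw [← Bergman.KLine_eq hα hg hg_one] at hdiff hderiv
  refine ⟨⟨hdiff, hderiv.differentiableAt⟩, ?_⟩
  have hle := Bergman.quadraticForm_le hα hR0 hR1 hg hh hgh
  rw [hnorm, one_pow, mul_one] at hle
  rw [Bergman.secondVariation, hderiv.deriv, hnorm, hconf.I_pert_zero,
    ← Bergman.momentRatio_sub_eq hs hR2]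
  linarith
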